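/- Let $0\le\gamma<1$, $\delta>0$, $\kappa_1=\frac1{\delta+\gamma}$, $\kappa_2=1-\gamma$, $\lambda=\frac{\delta^2-\gamma}{(\delta+\gamma)^2}$, let $a<0$, $d>0$, and let $T>0$ and $\mu>3/2$ be real. Let $(f,g)=\int_0^1 f\bar g\,dx$ with norm $\|\cdot\|$, let $H^s$ be the Sobolev space of $1$-periodic functions with norm $\|g\|_s=\big(\sum_{k\in\mathbb Z}(1+k^2)^s|\hat g(k)|^2\big)^{1/2}$, $\hat g(k)=\int_0^1 g(x)e^{-2\pi ikx}\,dx$, and for an integer $N\ge1$ let $S_N=\mathrm{span}\{e^{2\pi ikx}: k\in\mathbb Z,\ |k|\le N\}$, with $P_N$ the $L^2$-projection onto $S_N$. Suppose that real-valued $\zeta,u\in C^1([0,T];H^\mu)$ solve, for $0\le t\le T$ and in the sense of periodic distributions in $x$, the system (case (vi): $b=c=0$) $$\zeta_t+\kappa_1u_x+\lambda(\zeta u)_x+a\,u_{xxx}=0,\qquad u_t+\kappa_2\zeta_x+\lambda uu_x-d\,u_{xxt}=0,$$ with $\zeta(\cdot,0)=\zeta_0$, $u(\cdot,0)=u_0$.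 Consider the spectral Galerkin semidiscretization: real-valued, differentiable $\zeta_N,u_N:[0,T]\to S_N$ with $\zeta_N(0)=P_N\zeta_0$, $u_N(0)=P_Nu_0$ and, for all $t\in[0,T]$ and $\varphi,\chi\in S_N$, $$(\zeta_{Nt},\varphi)+\kappa_1(u_{Nx},\varphi)+\lambda((\zeta_Nu_N)_x,\varphi)+a(u_{Nxxx},\varphi)=0,$$ $$(u_{Nt},\chi)+\kappa_2(\zeta_{Nx},\chi)+\lambda(u_Nu_{Nx},\chi)-d(u_{Nxxt},\chi)=0.$$ Then there is a constant $C$ independent of $N$ such that, for every $N\ge1$ for which the semidiscrete solution exists on all of $[0,T]$, $$\max_{0\le t\le T}\big(\|\zeta_N-\zeta\|+\|u_N-u\|_1\big)\le C\,N^{1-\mu};$$ moreover, for all sufficiently large $N$ the semidiscrete solution exists on $[0,T]$ and is unique. -/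

import Mathlib

open Set Filter Topology
open scoped ContDiff

/-- The parameters of the one-dimensional Boussinesq/Boussinesq system: the density ratio `γ`,
the depth ratio `δ` and the four coefficients `a`, `b`, `c`, `d`. -/
structure BBParams where
  γ : ℝ
  δ : ℝ
  a : ℝ
  b : ℝ
  c : ℝ
  d : ℝ

noncomputable section

namespace BBParams

/-- `κ₁ = 1 / (δ + γ)`. -/
def κ₁ (p : BBParams) : ℝ := 1 / (p.δ + p.γ)

/-- `κ₂ = 1 - γ`. -/
def κ₂ (p : BBParams) : ℝ := 1 - p.γ

/-- `lam = (δ² - γ) / (δ + γ)²`, the coefficient of the nonlinear terms. -/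
def lam (p : BBParams) : ℝ := (p.δ ^ 2 - p.γ) / (p.δ + p.γ) ^ 2

/-- `c' = (1 - γ) c`. -/
def c' (p : BBParams) : ℝ := (1 - p.γ) * p.c

/-- The physical range of the density and depth ratios (`γ = 0` is the surface-wave limit). -/
def Physical (p : BBParams) : Prop := 0 ≤ p.γ ∧ p.γ < 1 ∧ 0 < p.δ

/-- Case (vi): `b = 0`, `d > 0`, `a < 0`, `c = 0`. -/
def CaseVI (p : BBParams) : Prop := p.b = 0 ∧ 0 < p.d ∧ p.a < 0 ∧ p.c = 0

end BBParams

namespace BB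

/-- The exponential `x ↦ e^{2πikx}` of period `1`. -/
def expo (k : ℤ) (x : ℝ) : ℂ := Complex.exp (2 * Real.pi * Complex.I * k * x)

/-- The `k`-th Fourier coefficient of a real function of period `1`. -/
def fhat (g : ℝ → ℝ) (k : ℤ) : ℂ := ∫ x in (0 : ℝ)..1, (g x : ℂ) * expo (-k) x

/-- The inner product `(f, g) = ∫₀¹ f ḡ` of `L²(0,1)`. -/
def ip (f g : ℝ → ℂ) : ℂ := ∫ x in (0 : ℝ)..1, f x * (starRingEnd ℂ) (g x)

/-- The norm of `L²(0,1)`. -/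
def l2Norm (g : ℝ → ℝ) : ℝ := Real.sqrt (∫ x in (0 : ℝ)..1, g x ^ 2)

/-- `g` belongs to the `L²`-based Sobolev space `H^s` of functions of period `1`, `s ≥ 0`. -/
structure MemSobolev (s : ℝ) (g : ℝ → ℝ) : Prop where
  periodic : Function.Periodic g 1
  memLp : MeasureTheory.MemLp g 2 (MeasureTheory.volume.restrict (Ioc (0 : ℝ) 1))
  summable : Summable fun k : ℤ => (1 + (k : ℝ) ^ 2) ^ s * ‖fhat g k‖ ^ 2

/-- The norm of `H^s`. -/
def sobolevNorm (s : ℝ) (g : ℝ → ℝ) : ℝ :=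
  Real.sqrt (∑' k : ℤ, (1 + (k : ℝ) ^ 2) ^ s * ‖fhat g k‖ ^ 2)

/-- `f ∈ C¹([0,T]; H^s)` with time derivative `f'`; both the derivative and its continuity are
understood in the norm of `H^s`.  The first argument of `f` and `f'` is time. -/
structure IsC1Sobolev (s T : ℝ) (f f' : ℝ → ℝ → ℝ) : Prop where
  mem : ∀ t ∈ Icc 0 T, MemSobolev s (f t)
  mem_deriv : ∀ t ∈ Icc 0 T, MemSobolev s (f' t)
  tendsto_slope : ∀ t ∈ Icc 0 T,
    Tendsto (fun r => sobolevNorm s (fun x => (f r x - f t x) / (r - t) - f' t x))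
      (𝓝[Icc 0 T \ {t}] t) (𝓝 0)
  continuous_deriv : ∀ t ∈ Icc 0 T,
    Tendsto (fun r => sobolevNorm s (fun x => f' r x - f' t x)) (𝓝[Icc 0 T] t) (𝓝 0)

/-- `(ζ, u)` with `ζ, u ∈ C¹([0,T]; H^s)` solves the periodic initial-value problem
`ζ_t + κ₁ u_x + lam (ζ u)_x + a u_xxx - b ζ_xxt = 0`,
`u_t + κ₂ ζ_x + lam u u_x + c' ζ_xxx - d u_xxt = 0`, `ζ(0) = ζ₀`, `u(0) = u₀`.
For every time in `[0,T]` the equations hold in the sense of periodic distributions in `x`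
(as `u_xxx` need not be a function when `u ∈ H^s`); `u u_x` is read as `(u² / 2)_x`. -/
def IsSolution (p : BBParams) (s T : ℝ) (ζ₀ u₀ : ℝ → ℝ) (ζ u : ℝ → ℝ → ℝ) : Prop :=
  (∀ x, ζ 0 x = ζ₀ x) ∧ (∀ x, u 0 x = u₀ x) ∧
  ∃ ζt ut : ℝ → ℝ → ℝ, IsC1Sobolev s T ζ ζt ∧ IsC1Sobolev s T u ut ∧
    ∀ t ∈ Icc 0 T, ∀ φ : ℝ → ℝ, ContDiff ℝ ∞ φ → Function.Periodic φ 1 →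
      (∫ x in (0 : ℝ)..1, ζt t x * φ x)
          - p.κ₁ * (∫ x in (0 : ℝ)..1, u t x * deriv φ x)
          - p.lam * (∫ x in (0 : ℝ)..1, (ζ t x * u t x) * deriv φ x)
          - p.a * (∫ x in (0 : ℝ)..1, u t x * iteratedDeriv 3 φ x)
          - p.b * (∫ x in (0 : ℝ)..1, ζt t x * iteratedDeriv 2 φ x) = 0 ∧
      (∫ x in (0 : ℝ)..1, ut t x * φ x)
          - p.κ₂ * (∫ x in (0 : ℝ)..1, ζ t x * deriv φ x)
          - p.lam * (∫ x in (0 : ℝ)..1, (u t x ^ 2 / 2) * deriv φ x)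
          - p.c' * (∫ x in (0 : ℝ)..1, ζ t x * iteratedDeriv 3 φ x)
          - p.d * (∫ x in (0 : ℝ)..1, ut t x * iteratedDeriv 2 φ x) = 0

/-- The space `S_N` of trigonometric polynomials of degree at most `N` and period `1`. -/
def trigSpace (N : ℕ) : Submodule ℂ (ℝ → ℂ) :=
  Submodule.span ℂ (expo '' Icc (-(N : ℤ)) N)

/-- The `L²`-projection `P_N` onto `S_N`. -/
def proj (N : ℕ) (g : ℝ → ℝ) (x : ℝ) : ℂ :=
  ∑ k ∈ Finset.Icc (-(N : ℤ)) N, fhat g k * expo k x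

/-- A real function regarded as a complex one. -/
def toC (g : ℝ → ℝ) (x : ℝ) : ℂ := (g x : ℂ)

/-- `ζN, uN : [0,T] → S_N`, real valued, solve the spectral Fourier-Galerkin semidiscretization
of the initial-value problem on the whole interval `[0,T]`.  As `S_N` has finite dimension, time
derivatives may be taken for each fixed `x`; they are one-sided at the end points. -/
structure IsSemidiscrete (p : BBParams) (T : ℝ) (N : ℕ) (ζ₀ u₀ : ℝ → ℝ)
    (ζN uN : ℝ → ℝ → ℝ) : Prop where
  mem_ζ : ∀ t ∈ Icc 0 T, toC (ζN t) ∈ trigSpace N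
  mem_u : ∀ t ∈ Icc 0 T, toC (uN t) ∈ trigSpace N
  init_ζ : toC (ζN 0) = proj N ζ₀
  init_u : toC (uN 0) = proj N u₀
  galerkin : ∀ t ∈ Icc 0 T, ∃ ζNt uNt : ℝ → ℝ,
    (∀ x, HasDerivWithinAt (fun r => ζN r x) (ζNt x) (Icc 0 T) t) ∧
    (∀ x, HasDerivWithinAt (fun r => uN r x) (uNt x) (Icc 0 T) t) ∧
    (∀ φ ∈ trigSpace N,
      ip (toC ζNt) φ + p.κ₁ * ip (toC (deriv (uN t))) φ
        + p.lam * ip (toC (deriv fun x => ζN t x * uN t x)) φ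
        + p.a * ip (toC (iteratedDeriv 3 (uN t))) φ
        - p.b * ip (toC (iteratedDeriv 2 ζNt)) φ = 0) ∧
    (∀ χ ∈ trigSpace N,
      ip (toC uNt) χ + p.κ₂ * ip (toC (deriv (ζN t))) χ
        + p.lam * ip (toC (fun x => uN t x * deriv (uN t) x)) χ
        + p.c' * ip (toC (iteratedDeriv 3 (ζN t))) χ
        - p.d * ip (toC (iteratedDeriv 2 uNt)) χ = 0)

end BB

end

/-! The argument is an energy estimate on the Fourier side. Let `A`, `B` be the coefficients of ζ_N
- P_N ζ and u_N - P_N u. The quantity `energy` weights |A_k|² by κ₂ and |B_k|² by (κ₁ - aω²)(1 +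
dω²), where ω = 2πk. The factor 1 + dω² undoes the inversion of 1 - d∂ₓ² in the u equation, and κ₁ -
aω² is, up to the symbol of ∂ₓ, the symbol through which u enters the ζ equation linearly. With
these weights the linear terms cancel exactly (`energyRate_eq`). Since a < 0 < d, the energy
controls A in L² and B in H².

The nonlinear terms each carry one derivative. Only in the product A·u_N does it meet a factor known
merely in L²; since u_N is real, integration by parts moves it onto u_N (`transport_le`). Elsewhere
there is a derivative to spare: B lies in H², and the truncation tails of ζ and u are of size
N^{1-μ} in H¹ (`MemSobolev.tail_le`), which fixes the rate. As μ > 3/2, the coefficients of ζ and u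
are summable with weight 1 + |k|, so products are bounded by Schur's test (`schur`). The outcome is
E' ≤ K(E + τ) with τ of order N^{2(1-μ)} and K independent of N, valid while E ≤ 1
(`exists_energyRate_le`). As E(0) = 0, a barrier argument (`le_of_deriv_le`) gives E = O(N^{2(1-μ)})
on all of [0,T] once N is large.

For existence the Galerkin vector field is cut off outside a ball. The same estimate applies to the
resulting global curve and shows that it never feels the cutoff. Uniqueness holds because the field
is C¹ in finite dimension. For each of the finitely many remaining N there is at most one solution;
its error is bounded, and the bound is absorbed into the constant. -/

noncomputable section

namespace BB

open MeasureTheory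

/-! ### Exponentials, Fourier coefficients and trigonometric polynomials -/

/-- The symbol of `d/dx`. -/
def sym (k : ℤ) : ℂ := 2 * Real.pi * Complex.I * k

lemma expo_eq (k : ℤ) (x : ℝ) : expo k x = Complex.exp (sym k * x) := rfl

lemma expo_eq_fourier (k : ℤ) (x : ℝ) : expo k x = fourier k (x : AddCircle (1 : ℝ)) := by
  rw [fourier_coe_apply, expo]; simp

lemma expo_zero (x : ℝ) : expo 0 x = 1 := by simp [expo]

lemma expo_add (j k : ℤ) (x : ℝ) : expo (j + k) x = expo j x * expo k x := by
  rw [expo, expo, expo, ← Complex.exp_add]; push_cast; ring_nf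

lemma conj_expo (k : ℤ) (x : ℝ) : (starRingEnd ℂ) (expo k x) = expo (-k) x := by
  rw [expo, expo, ← Complex.exp_conj]; simp [map_ofNat]

lemma sym_neg (k : ℤ) : sym (-k) = - sym k := by simp [sym]

lemma sym_sub (j k : ℤ) : sym (j - k) = sym j - sym k := by simp [sym]; ring

lemma conj_sym (k : ℤ) : (starRingEnd ℂ) (sym k) = - sym k := by simp [sym, map_ofNat]

lemma hasDerivAt_expo (k : ℤ) (x : ℝ) : HasDerivAt (expo k) (sym k * expo k x) x := by
  have h : HasDerivAt (fun y : ℝ => sym k * (y : ℂ)) (sym k * 1) x :=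
    (Complex.ofRealCLM.hasDerivAt (x := x)).const_mul _
  have := h.cexp
  rw [mul_one, mul_comm] at this
  exact this

lemma contDiff_expo (k : ℤ) : ContDiff ℝ ∞ (expo k) := by
  have : expo k = fun x : ℝ => Complex.exp (sym k * Complex.ofRealCLM x) := rfl
  rw [this]
  exact (contDiff_const.mul Complex.ofRealCLM.contDiff).cexp

lemma continuous_expo (k : ℤ) : Continuous (expo k) := (contDiff_expo k).continuous

lemma norm_expo (k : ℤ) (x : ℝ) : ‖expo k x‖ = 1 := by
  have : expo k x = Complex.exp (((2 * Real.pi * k * x : ℝ) : ℂ) * Complex.I) := by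
    rw [expo]; push_cast; ring_nf
  rw [this, Complex.norm_exp_ofReal_mul_I]

lemma periodic_expo (k : ℤ) : Function.Periodic (expo k) 1 := by
  intro x
  rw [expo_eq_fourier, expo_eq_fourier]
  congr 1
  simp

lemma integral_expo (k : ℤ) : ∫ x in (0 : ℝ)..1, expo k x = if k = 0 then 1 else 0 := by
  split_ifs with h
  · subst h; simp [expo_zero]
  · have hk : sym k ≠ 0 := by
      simp [sym, h, Real.pi_ne_zero]
    have := intervalIntegral.integral_eq_sub_of_hasDerivAt (a := 0) (b := 1)
      (f := fun x => (sym k)⁻¹ * expo k x) (f' := expo k)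
      (fun x _ => by
        have := (hasDerivAt_expo k x).const_mul (sym k)⁻¹
        rwa [← mul_assoc, inv_mul_cancel₀ hk, one_mul] at this)
      ((continuous_expo k).intervalIntegrable _ _)
    rw [this]
    have h1 : expo k 1 = expo k 0 := by simpa using periodic_expo k 0
    simp [h1]

/-- The `k`-th Fourier coefficient of a complex function of period `1`. -/
def coeff (F : ℝ → ℂ) (k : ℤ) : ℂ := ∫ x in (0 : ℝ)..1, F x * expo (-k) x

lemma fhat_eq_coeff (g : ℝ → ℝ) (k : ℤ) : fhat g k = coeff (toC g) k := rfl

lemma fhat_neg (g : ℝ → ℝ) (k : ℤ) : fhat g (-k) = (starRingEnd ℂ) (fhat g k) := by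
  rw [fhat, fhat, intervalIntegral.intervalIntegral_eq_integral_uIoc,
    intervalIntegral.intervalIntegral_eq_integral_uIoc]
  simp only [zero_le_one, if_true, one_smul]
  rw [← integral_conj]
  simp [conj_expo]

lemma coeff_mul_expo (F : ℝ → ℂ) (j k : ℤ) :
    coeff (fun x => F x * expo j x) k = coeff F (k - j) := by
  simp only [coeff]
  congr 1; ext x
  rw [mul_assoc, ← expo_add]; congr 2; ring

lemma ip_expo (F : ℝ → ℂ) (k : ℤ) : ip F (expo k) = coeff F k := by
  simp only [ip, coeff, conj_expo]

/-- Finite trigonometric sums. -/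
def trig (s : Finset ℤ) (c : ℤ → ℂ) (x : ℝ) : ℂ := ∑ k ∈ s, c k * expo k x

lemma coeff_expo (j k : ℤ) : coeff (expo j) k = if j = k then 1 else 0 := by
  have := integral_expo (j - k)
  simp only [sub_eq_add_neg, expo_add] at this
  rw [coeff, this, ← sub_eq_add_neg]
  simp [sub_eq_zero]

lemma coeff_trig_mul (s : Finset ℤ) (c : ℤ → ℂ) {G : ℝ → ℂ} (hG : Continuous G) (k : ℤ) :
    coeff (fun x => trig s c x * G x) k = ∑ j ∈ s, c j * coeff G (k - j) := by
  have h : ∀ j, coeff G (k - j) = ∫ x in (0 : ℝ)..1, (G x * expo j x) * expo (-k) x :=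
    fun j => (coeff_mul_expo G j k).symm
  simp only [h, ← intervalIntegral.integral_const_mul]
  rw [coeff, ← intervalIntegral.integral_finsetSum]
  · congr 1; ext x; rw [trig, Finset.sum_mul, Finset.sum_mul]
    exact Finset.sum_congr rfl fun j _ => by ring
  · intro j _
    apply Continuous.intervalIntegrable
    have := continuous_expo j
    have := continuous_expo (-k)
    fun_prop

lemma coeff_trig (s : Finset ℤ) (c : ℤ → ℂ) (k : ℤ) :
    coeff (trig s c) k = if k ∈ s then c k else 0 := by
  have := coeff_trig_mul s c (G := expo 0) (continuous_expo 0) k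
  simp only [expo_zero, mul_one, coeff_expo] at this
  have h2 : coeff (trig s c) k = coeff (fun x => trig s c x) k := rfl
  rw [h2, this]
  have h3 : ∀ j, (0 = k - j) ↔ (k = j) := fun j => by constructor <;> intro h <;> linarith
  simp only [h3, mul_ite, mul_one, mul_zero, Finset.sum_ite_eq]

lemma contDiff_trig (s : Finset ℤ) (c : ℤ → ℂ) : ContDiff ℝ ∞ (trig s c) := by
  unfold trig
  exact ContDiff.sum fun k _ => contDiff_const.mul (contDiff_expo k)

lemma periodic_trig (s : Finset ℤ) (c : ℤ → ℂ) : Function.Periodic (trig s c) 1 := by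
  intro x
  simp only [trig, periodic_expo _ x]

/-- The frequencies of `S_N`. -/
abbrev freq (N : ℕ) : Finset ℤ := Finset.Icc (-(N : ℤ)) N

lemma neg_mem_freq {N : ℕ} {k : ℤ} : -k ∈ freq N ↔ k ∈ freq N := by
  simp only [freq, Finset.mem_Icc]; omega

lemma trig_mem_trigSpace (N : ℕ) (c : ℤ → ℂ) : trig (freq N) c ∈ trigSpace N := by
  have : trig (freq N) c = ∑ k ∈ freq N, c k • expo k := by
    ext x; simp [trig]
  rw [this]
  refine Submodule.sum_mem _ fun k hk => Submodule.smul_mem _ _ (Submodule.subset_span ⟨k, ?_, rfl⟩)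
  simpa using hk

lemma exists_trig_of_mem {N : ℕ} {F : ℝ → ℂ} (h : F ∈ trigSpace N) :
    ∃ c, F = trig (freq N) c := by
  induction h using Submodule.span_induction with
  | mem F hF =>
    obtain ⟨k, hk, rfl⟩ := hF
    refine ⟨fun j => if j = k then 1 else 0, ?_⟩
    ext x
    have : k ∈ freq N := by simpa using hk
    simp only [trig, ite_mul, one_mul, zero_mul, Finset.sum_ite_eq', this, if_true]
  | zero => exact ⟨0, by ext x; simp [trig]⟩
  | add F G _ _ hF hG =>
    obtain ⟨c, rfl⟩ := hF
    obtain ⟨e, rfl⟩ := hG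
    exact ⟨c + e, by ext x; simp [trig, add_mul, Finset.sum_add_distrib]⟩
  | smul a F _ hF =>
    obtain ⟨c, rfl⟩ := hF
    exact ⟨a • c, by ext x; simp [trig, mul_assoc, Finset.mul_sum]⟩

lemma eq_trig_of_mem {N : ℕ} {g : ℝ → ℝ} (h : toC g ∈ trigSpace N) :
    toC g = trig (freq N) (fhat g) := by
  obtain ⟨c, hc⟩ := exists_trig_of_mem h
  ext x
  rw [hc]
  simp only [trig, fhat_eq_coeff, hc, coeff_trig]
  exact Finset.sum_congr rfl fun k hk => by rw [if_pos hk]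

lemma fhat_eq_zero_of_mem {N : ℕ} {g : ℝ → ℝ} (h : toC g ∈ trigSpace N) {k : ℤ}
    (hk : k ∉ freq N) : fhat g k = 0 := by
  rw [fhat_eq_coeff, eq_trig_of_mem h, coeff_trig, if_neg hk]

lemma contDiff_of_mem {N : ℕ} {g : ℝ → ℝ} (h : toC g ∈ trigSpace N) : ContDiff ℝ ∞ g := by
  have h2 : g = fun x => Complex.reCLM (toC g x) := by ext x; simp [toC]
  rw [h2, eq_trig_of_mem h]
  exact Complex.reCLM.contDiff.comp (contDiff_trig _ _)

lemma periodic_of_mem {N : ℕ} {g : ℝ → ℝ} (h : toC g ∈ trigSpace N) : Function.Periodic g 1 := by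
  intro x
  have := periodic_trig (freq N) (fhat g) x
  rw [← eq_trig_of_mem h] at this
  exact Complex.ofReal_injective this

/-- Reflecting `k ↦ -k` shows that the sum is its own conjugate, so the real part loses nothing.
This turns symmetric coefficient families back into real-valued elements of S_N. -/
lemma toC_re_trig {N : ℕ} {c : ℤ → ℂ} (hc : ∀ k, c (-k) = (starRingEnd ℂ) (c k)) :
    toC (fun x => (trig (freq N) c x).re) = trig (freq N) c := by
  ext x
  apply Complex.conj_eq_iff_re.1
  rw [trig, map_sum]
  refine Finset.sum_nbij' (fun k => -k) (fun k => -k) ?_ ?_ ?_ ?_ ?_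
  · intro k hk; exact neg_mem_freq.2 hk
  · intro k hk; exact neg_mem_freq.2 hk
  · simp
  · simp
  · intro k _; rw [map_mul, conj_expo, hc]

lemma periodic_deriv {g : ℝ → ℝ} (hg : Function.Periodic g 1) :
    Function.Periodic (deriv g) 1 := by
  intro x
  have h : (fun y => g (y + 1)) = g := funext hg
  rw [← deriv_comp_add_const, h]

lemma fhat_deriv {g : ℝ → ℝ} (hg : ContDiff ℝ 1 g) (hp : Function.Periodic g 1) (k : ℤ) :
    fhat (deriv g) k = sym k * fhat g k := by
  have hd : ∀ x, HasDerivAt (fun y => (g y : ℂ)) ((deriv g x : ℝ) : ℂ) x := fun x =>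
    ((hg.differentiable (by simp)) x).hasDerivAt.ofReal_comp
  have hc : Continuous (deriv g) := hg.continuous_deriv (by simp)
  have hgc := hg.continuous
  have := intervalIntegral.integral_mul_deriv_eq_deriv_mul (a := 0) (b := 1)
    (u := expo (-k)) (v := fun x => (g x : ℂ)) (u' := fun x => sym (-k) * expo (-k) x)
    (v' := fun x => ((deriv g x : ℝ) : ℂ))
    (fun x _ => hasDerivAt_expo (-k) x) (fun x _ => hd x)
    (by have := continuous_expo (-k); exact Continuous.intervalIntegrable (by fun_prop) _ _)
    (Continuous.intervalIntegrable (by fun_prop) _ _)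
  have h1 : expo (-k) 1 = expo (-k) 0 := by simpa using periodic_expo (-k) 0
  have h2 : g 1 = g 0 := by simpa using hp 0
  rw [h1, h2, sub_self, zero_sub] at this
  have e1 : fhat (deriv g) k = ∫ x in (0:ℝ)..1, expo (-k) x * ((deriv g x : ℝ) : ℂ) := by
    rw [fhat]; congr 1; ext x; ring
  rw [e1, this, fhat, ← intervalIntegral.integral_const_mul, ← intervalIntegral.integral_neg]
  congr 1; ext x; rw [sym_neg]; ring

lemma fhat_iteratedDeriv {g : ℝ → ℝ} (hg : ContDiff ℝ ∞ g) (hp : Function.Periodic g 1) (n : ℕ)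
    (k : ℤ) : fhat (iteratedDeriv n g) k = sym k ^ n * fhat g k := by
  induction n generalizing g with
  | zero => simp
  | succ n ih =>
    rw [iteratedDeriv_succ', ih (hg.deriv' ) (periodic_deriv hp),
      fhat_deriv (hg.of_le (by simp)) hp]
    ring

/-! ### Parseval's identity and coefficients of products -/

/-- Square integrability over a period. -/
abbrev SqInt {E : Type*} [NormedAddCommGroup E] (F : ℝ → E) : Prop :=
  MemLp F 2 (volume.restrict (Ioc (0 : ℝ) 1))

lemma fourierCoeff_lift (F : ℝ → ℂ) (k : ℤ) :
    fourierCoeff (AddCircle.liftIoc 1 0 F) k = coeff F k := by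
  rw [fourierCoeff_eq_intervalIntegral _ _ 0, coeff, zero_add]
  simp only [one_div, inv_one, one_smul]
  rw [intervalIntegral.integral_of_le zero_le_one, intervalIntegral.integral_of_le zero_le_one]
  refine setIntegral_congr_fun measurableSet_Ioc fun x hx => ?_
  rw [AddCircle.liftIoc_coe_apply (by simpa using hx), ← expo_eq_fourier, smul_eq_mul, mul_comm]

/-- Parseval's identity for the inner product of two functions. -/
lemma hasSum_coeff_mul_conj {F G : ℝ → ℂ} (hF : SqInt F) (hG : SqInt G) :
    HasSum (fun j => coeff F j * (starRingEnd ℂ) (coeff G j))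
      (∫ x in (0 : ℝ)..1, F x * (starRingEnd ℂ) (G x)) := by
  have hF' : MemLp (AddCircle.liftIoc (1 : ℝ) 0 F) 2 AddCircle.haarAddCircle :=
    (MemLp.memLp_liftIoc (by simpa using hF)).haarAddCircle
  have hG' : MemLp (AddCircle.liftIoc (1 : ℝ) 0 G) 2 AddCircle.haarAddCircle :=
    (MemLp.memLp_liftIoc (by simpa using hG)).haarAddCircle
  have key := fourierBasis.hasSum_inner_mul_inner (hG'.toLp) (hF'.toLp)
  have h1 : ∀ j, inner ℂ (fourierBasis j) (hF'.toLp) = coeff F j := fun j => by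
    rw [← fourierBasis.repr_apply_apply, fourierBasis_repr,
      fourierCoeff_congr_ae hF'.coeFn_toLp, fourierCoeff_lift]
  have h2 : ∀ j, inner ℂ (hG'.toLp) (fourierBasis j) = (starRingEnd ℂ) (coeff G j) := fun j => by
    rw [← inner_conj_symm, ← fourierBasis.repr_apply_apply, fourierBasis_repr,
      fourierCoeff_congr_ae hG'.coeFn_toLp, fourierCoeff_lift]
  have h3 : inner ℂ (hG'.toLp) (hF'.toLp) = ∫ x in (0 : ℝ)..1, F x * (starRingEnd ℂ) (G x) := by
    rw [L2.inner_def]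
    have : ∫ a, inner ℂ ((hG'.toLp _ : AddCircle (1 : ℝ) → ℂ) a) ((hF'.toLp _ : AddCircle (1 : ℝ) → ℂ) a) ∂(AddCircle.haarAddCircle (T := (1 : ℝ)))
        = ∫ a, AddCircle.liftIoc (1 : ℝ) 0 (fun x => F x * (starRingEnd ℂ) (G x)) a
          ∂AddCircle.haarAddCircle := by
      apply integral_congr_ae
      filter_upwards [hF'.coeFn_toLp, hG'.coeFn_toLp] with a h1 h2
      rw [h1, h2, RCLike.inner_apply]
      rfl
    rw [this, AddCircle.integral_haarAddCircle, AddCircle.integral_liftIoc_eq_intervalIntegral]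
    simp
  simp only [h1, h2, h3] at key
  simpa only [mul_comm] using key

lemma sqInt_toC {f : ℝ → ℝ} (hf : SqInt f) : SqInt (toC f) := hf.ofReal

lemma sqInt_mul_expo {F : ℝ → ℂ} (hF : SqInt F) (k : ℤ) : SqInt (fun x => F x * expo k x) := by
  refine MemLp.of_le hF (hF.1.mul (continuous_expo k).aestronglyMeasurable) (ae_of_all _ fun x => ?_)
  rw [norm_mul, norm_expo, mul_one]

lemma hasSum_norm_sq_fhat {f : ℝ → ℝ} (hf : SqInt f) :
    HasSum (fun k => ‖fhat f k‖ ^ 2) (∫ x in (0 : ℝ)..1, f x ^ 2) := by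
  have := hasSum_coeff_mul_conj (sqInt_toC hf) (sqInt_toC hf)
  have h2 : ∫ x in (0 : ℝ)..1, toC f x * (starRingEnd ℂ) (toC f x)
      = ((∫ x in (0 : ℝ)..1, f x ^ 2 : ℝ) : ℂ) := by
    rw [← intervalIntegral.integral_ofReal]
    congr 1; ext x; simp [toC, sq]
  rw [h2] at this
  have h3 := Complex.hasSum_re this
  simp only [Complex.mul_conj, Complex.ofReal_re, ← fhat_eq_coeff] at h3
  simpa only [Complex.normSq_eq_norm_sq] using h3

/-- The Fourier coefficients of a product are the convolution of the Fourier coefficients. -/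
lemma hasSum_fhat_mul {f g : ℝ → ℝ} (hf : SqInt f) (hg : SqInt g) (k : ℤ) :
    HasSum (fun j => fhat f j * fhat g (k - j)) (fhat (fun x => f x * g x) k) := by
  have hG : SqInt (fun x => toC g x * expo k x) := sqInt_mul_expo (sqInt_toC hg) k
  have := hasSum_coeff_mul_conj (sqInt_toC hf) hG
  convert this using 1
  · ext j
    rw [coeff_mul_expo, ← fhat_eq_coeff, ← fhat_eq_coeff, ← fhat_neg]
    congr 2; ring
  · rw [fhat]
    congr 1; ext x
    rw [map_mul, conj_expo]
    simp [toC, mul_assoc]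

lemma intervalIntegrable_of_sqInt {f : ℝ → ℝ} (hf : SqInt f) {φ : ℝ → ℂ} (hφ : Continuous φ) :
    IntervalIntegrable (fun x => (f x : ℂ) * φ x) volume 0 1 := by
  have h1 : IntervalIntegrable f volume 0 1 := by
    rw [intervalIntegrable_iff_integrableOn_Ioc_of_le zero_le_one]
    exact hf.integrable (by norm_num)
  have h2 : IntervalIntegrable (fun x => (f x : ℂ)) volume 0 1 :=
    ⟨h1.1.ofReal, h1.2.ofReal⟩
  exact h2.mul_continuousOn hφ.continuousOn

lemma fhat_sub {f g : ℝ → ℝ} (hf : SqInt f) (hg : SqInt g) (k : ℤ) :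
    fhat (fun x => f x - g x) k = fhat f k - fhat g k := by
  rw [fhat, fhat, fhat, ← intervalIntegral.integral_sub
    (intervalIntegrable_of_sqInt hf (continuous_expo _))
    (intervalIntegrable_of_sqInt hg (continuous_expo _))]
  congr 1; ext x; push_cast; ring

lemma fhat_div {f : ℝ → ℝ} (c : ℝ) (k : ℤ) :
    fhat (fun x => f x / c) k = fhat f k / c := by
  rw [fhat, fhat, ← intervalIntegral.integral_div]
  congr 1; ext x; push_cast; ring

/-! ### Sobolev norms and C¹ curves in Sobolev spaces -/

lemma weight_pos (s : ℝ) (k : ℤ) : 0 < (1 + (k : ℝ) ^ 2) ^ s := by positivity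

lemma norm_sub_sq_le (a b : ℂ) : ‖a - b‖ ^ 2 ≤ 2 * ‖a‖ ^ 2 + 2 * ‖b‖ ^ 2 := by
  have h := norm_sub_le a b
  have h0 := norm_nonneg (a - b)
  nlinarith [sq_nonneg (‖a‖ - ‖b‖)]

lemma MemSobolev.sub {s : ℝ} {f g : ℝ → ℝ} (hf : MemSobolev s f) (hg : MemSobolev s g) :
    MemSobolev s (fun x => f x - g x) where
  periodic x := by simp only [hf.periodic x, hg.periodic x]
  memLp := hf.memLp.sub hg.memLp
  summable := by
    refine Summable.of_nonneg_of_le (fun k => mul_nonneg (weight_pos s k).le (sq_nonneg _)) (fun k => ?_)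
      ((hf.summable.mul_left 2).add (hg.summable.mul_left 2))
    rw [fhat_sub hf.memLp hg.memLp]
    have := mul_le_mul_of_nonneg_left (norm_sub_sq_le (fhat f k) (fhat g k)) (weight_pos s k).le
    linarith

lemma MemSobolev.div {s : ℝ} {f : ℝ → ℝ} (hf : MemSobolev s f) (c : ℝ) :
    MemSobolev s (fun x => f x / c) where
  periodic x := by show f (x + 1) / c = f x / c; rw [hf.periodic x]
  memLp := by simpa only [div_eq_mul_inv] using hf.memLp.mul_const c⁻¹
  summable := by
    simp only [fhat_div, norm_div, div_pow]
    simpa only [div_eq_mul_inv, mul_assoc] using hf.summable.mul_right ((‖(c : ℂ)‖ ^ 2)⁻¹)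

/-- The square of the Sobolev norm. -/
def sobSq (s : ℝ) (g : ℝ → ℝ) : ℝ := ∑' k : ℤ, (1 + (k : ℝ) ^ 2) ^ s * ‖fhat g k‖ ^ 2

lemma sobSq_nonneg (s : ℝ) (g : ℝ → ℝ) : 0 ≤ sobSq s g :=
  tsum_nonneg fun k => mul_nonneg (weight_pos s k).le (sq_nonneg _)

lemma sobSq_lt_one {s : ℝ} {g : ℝ → ℝ} (h : sobolevNorm s g < 1) : sobSq s g < 1 := by
  have := (Real.sqrt_lt' one_pos).1 h
  rwa [one_pow] at this

lemma norm_fhat_le {s : ℝ} (hs : 0 ≤ s) {g : ℝ → ℝ} (hg : MemSobolev s g) (k : ℤ) :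
    ‖fhat g k‖ ≤ sobolevNorm s g := by
  apply Real.le_sqrt_of_sq_le
  refine le_trans ?_ (hg.summable.le_tsum k fun j _ => mul_nonneg (weight_pos s j).le (sq_nonneg _))
  have : 1 ≤ (1 + (k : ℝ) ^ 2) ^ s := Real.one_le_rpow (by nlinarith [sq_nonneg (k : ℝ)]) hs
  nlinarith [sq_nonneg ‖fhat g k‖]

/-- For `s ≥ 0` a single Fourier coefficient is bounded by the Sobolev norm, so convergence of
difference quotients in H^s passes to each mode. -/
lemma IsC1Sobolev.hasDerivWithinAt_fhat {s T : ℝ} (hs : 0 ≤ s) {f f' : ℝ → ℝ → ℝ}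
    (h : IsC1Sobolev s T f f') {t : ℝ} (ht : t ∈ Icc 0 T) (k : ℤ) :
    HasDerivWithinAt (fun r => fhat (f r) k) (fhat (f' t) k) (Icc 0 T) t := by
  rw [hasDerivWithinAt_iff_tendsto_slope, tendsto_iff_norm_sub_tendsto_zero]
  refine squeeze_zero' (Eventually.of_forall fun _ => norm_nonneg _) ?_ (h.tendsto_slope t ht)
  filter_upwards [self_mem_nhdsWithin] with r hr
  have hm := ((h.mem r hr.1).sub (h.mem t ht)).div (r - t)
  have := norm_fhat_le hs (hm.sub (h.mem_deriv t ht)) k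
  rw [fhat_sub hm.memLp (h.mem_deriv t ht).memLp, fhat_div,
    fhat_sub (h.mem r hr.1).memLp (h.mem t ht).memLp] at this
  have e : slope (fun r => fhat (f r) k) t r = (fhat (f r) k - fhat (f t) k) / ((r - t : ℝ) : ℂ) := by
    rw [slope_def_module, div_eq_inv_mul, Complex.real_smul, Complex.ofReal_inv]
  rwa [← e] at this

/-- Near each `t` the difference quotient stays close to `f' t`, which bounds `f r` locally;
compactness of [0,T] makes the bound uniform. -/
lemma IsC1Sobolev.sobSq_bounded {s T : ℝ} {f f' : ℝ → ℝ → ℝ}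
    (h : IsC1Sobolev s T f f') : ∃ M, ∀ t ∈ Icc 0 T, sobSq s (f t) ≤ M := by
  refine (isCompact_Icc (a := 0) (b := T)).induction_on
    (p := fun u => ∃ M, ∀ t ∈ u, sobSq s (f t) ≤ M) ⟨0, by simp⟩ ?_ ?_ ?_
  · rintro u v huv ⟨M, hM⟩
    exact ⟨M, fun t ht => hM t (huv ht)⟩
  · rintro u v ⟨M, hM⟩ ⟨M', hM'⟩
    refine ⟨max M M', ?_⟩
    rintro t (ht | ht)
    · exact (hM t ht).trans (le_max_left _ _)
    · exact (hM' t ht).trans (le_max_right _ _)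
  · intro t ht
    have hev := (h.tendsto_slope t ht).eventually (gt_mem_nhds one_pos)
    rw [eventually_nhdsWithin_iff] at hev
    -- The slope condition says nothing at `r = t`, so that point is added by hand and treated
    -- separately.
    have h2 : {r | r ∈ Icc 0 T ∧ (r ≠ t → sobolevNorm s (fun x => (f r x - f t x) / (r - t) - f' t x) < 1)}
        ∈ 𝓝[Icc 0 T] t := by
      have := eventually_nhdsWithin_of_eventually_nhds (s := Icc 0 T) hev
      filter_upwards [this, self_mem_nhdsWithin] with r hr hr2
      exact ⟨hr2, fun hne => hr ⟨hr2, hne⟩⟩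
    -- With remainder `e` of norm below 1, `f r = f t + (r - t)(e + f' t)`. The constants come from
    -- two uses of |x - y|² ≤ 2|x|² + 2|y|² and from |r - t| ≤ T.
    refine ⟨_, h2, sobSq s (f t) + 2 * sobSq s (f t) + 4 * T ^ 2 * (1 + sobSq s (f' t)), ?_⟩
    rintro r ⟨hr, hr2⟩
    by_cases hrt : r = t
    · subst hrt
      have := sobSq_nonneg s (f r)
      have := sobSq_nonneg s (f' r)
      have : 0 ≤ 4 * T ^ 2 * (1 + sobSq s (f' r)) := by positivity
      linarith
    · have hlt := sobSq_lt_one (hr2 hrt)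
      have hm := ((h.mem r hr).sub (h.mem t ht)).div (r - t)
      have hm2 := hm.sub (h.mem_deriv t ht)
      have hrt' : ((r - t : ℝ) : ℂ) ≠ 0 := by
        exact_mod_cast sub_ne_zero.2 hrt
      have hT2 : (r - t) ^ 2 ≤ T ^ 2 := by
        apply sq_le_sq'
        · linarith [hr.1, ht.2]
        · linarith [hr.2, ht.1]
      set e := fun x => (f r x - f t x) / (r - t) - f' t x with he
      have hpt : ∀ k : ℤ, (1 + (k : ℝ) ^ 2) ^ s * ‖fhat (f r) k‖ ^ 2 ≤
          2 * ((1 + (k : ℝ) ^ 2) ^ s * ‖fhat (f t) k‖ ^ 2) +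
          4 * T ^ 2 * ((1 + (k : ℝ) ^ 2) ^ s * ‖fhat e k‖ ^ 2 +
            (1 + (k : ℝ) ^ 2) ^ s * ‖fhat (f' t) k‖ ^ 2) := by
        intro k
        have hk : fhat e k = (fhat (f r) k - fhat (f t) k) / ((r - t : ℝ) : ℂ) - fhat (f' t) k := by
          rw [he, fhat_sub hm.memLp (h.mem_deriv t ht).memLp, fhat_div,
            fhat_sub (h.mem r hr).memLp (h.mem t ht).memLp]
        have e1 : fhat (f r) k = fhat (f t) k - (-(((r - t : ℝ) : ℂ) * (fhat e k - -fhat (f' t) k))) := by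
          rw [hk]; field_simp; ring
        have n1 := norm_sub_sq_le (fhat (f t) k) (-(((r - t : ℝ) : ℂ) * (fhat e k - -fhat (f' t) k)))
        rw [← e1, norm_neg, norm_mul, mul_pow, Complex.norm_real, Real.norm_eq_abs, sq_abs] at n1
        have n2 := norm_sub_sq_le (fhat e k) (-fhat (f' t) k)
        rw [norm_neg] at n2
        have n3 : (r - t) ^ 2 * ‖fhat e k - -fhat (f' t) k‖ ^ 2 ≤
            T ^ 2 * (2 * ‖fhat e k‖ ^ 2 + 2 * ‖fhat (f' t) k‖ ^ 2) :=
          mul_le_mul hT2 n2 (sq_nonneg _) (sq_nonneg _)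
        have n4 : ‖fhat (f r) k‖ ^ 2 ≤ 2 * ‖fhat (f t) k‖ ^ 2 +
            4 * T ^ 2 * (‖fhat e k‖ ^ 2 + ‖fhat (f' t) k‖ ^ 2) := by linarith
        have := mul_le_mul_of_nonneg_left n4 (weight_pos s k).le
        linarith
      have hs1 := (h.mem t ht).summable
      have hs2 := hm2.summable
      have hs3 := (h.mem_deriv t ht).summable
      have hle := (h.mem r hr).summable.tsum_le_tsum hpt
        ((hs1.mul_left 2).add ((hs2.add hs3).mul_left _))
      rw [(hs1.mul_left 2).tsum_add ((hs2.add hs3).mul_left _), tsum_mul_left, tsum_mul_left,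
        hs2.tsum_add hs3] at hle
      have hT0 : 0 ≤ 4 * T ^ 2 := by positivity
      have := mul_le_mul_of_nonneg_left (add_le_add_left hlt.le (sobSq s (f' t))) hT0
      have := sobSq_nonneg s (f t)
      change sobSq s (f r) ≤ 2 * sobSq s (f t) + 4 * T ^ 2 * (sobSq s e + sobSq s (f' t)) at hle
      linarith

/-! ### The weight `1 + |k|`, the embedding for s > 3/2, and tails -/

/-- The weight `1 + |k|`. -/
def wt (k : ℤ) : ℝ := 1 + |(k : ℝ)|

lemma one_le_wt (k : ℤ) : 1 ≤ wt k := by simp [wt]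

lemma wt_pos (k : ℤ) : 0 < wt k := one_pos.trans_le (one_le_wt k)

lemma wt_mul_le (j k : ℤ) : wt k ≤ wt j * wt (k - j) := by
  simp only [wt]; push_cast
  have h : |(k : ℝ)| ≤ |(j : ℝ)| + |(k : ℝ) - j| := by
    have := abs_add_le (j : ℝ) (k - j); simpa using this
  nlinarith [abs_nonneg (j : ℝ), abs_nonneg ((k : ℝ) - j),
    mul_nonneg (abs_nonneg (j : ℝ)) (abs_nonneg ((k : ℝ) - j))]

lemma norm_sym_le (k : ℤ) : ‖sym k‖ ≤ 2 * Real.pi * wt k := by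
  have : ‖sym k‖ = 2 * Real.pi * |(k : ℝ)| := by
    simp [sym, abs_of_pos Real.pi_pos]
  rw [this, wt]
  have := Real.pi_pos
  nlinarith

lemma wt_sq_le (k : ℤ) : wt k ^ 2 ≤ 2 * (1 + (k : ℝ) ^ 2) := by
  rw [wt, ← sq_abs (k : ℝ)]
  nlinarith [sq_nonneg (1 - |(k : ℝ)|)]

lemma le_wt_sq (k : ℤ) : 1 + (k : ℝ) ^ 2 ≤ wt k ^ 2 := by
  rw [wt, ← sq_abs (k : ℝ)]
  nlinarith [abs_nonneg (k : ℝ)]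

lemma summable_weight {r : ℝ} (hr : 1 / 2 < r) :
    Summable fun k : ℤ => (1 + (k : ℝ) ^ 2) ^ (-r) := by
  have h1 : Summable fun k : ℤ => |(k : ℝ)| ^ (-(2 * r)) :=
    Real.summable_abs_int_rpow (by linarith)
  refine Summable.of_norm_bounded_eventually h1 ?_
  -- The comparison fails at `k = 0`, where `|0| ^ (-(2 * r))` takes the value 0.
  have : ({0} : Set ℤ)ᶜ ∈ (cofinite : Filter ℤ) := (finite_singleton 0).compl_mem_cofinite
  filter_upwards [this] with k hk
  have hk' : 0 < |(k : ℝ)| := abs_pos.2 (by exact_mod_cast hk)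
  rw [Real.norm_of_nonneg (weight_pos _ k).le]
  have e : |(k : ℝ)| ^ (-(2 * r)) = (|(k : ℝ)| ^ 2) ^ (-r) := by
    rw [← Real.rpow_natCast, ← Real.rpow_mul (abs_nonneg _)]
    congr 1; push_cast; ring
  rw [e]
  apply Real.rpow_le_rpow_of_nonpos (by positivity)
  · rw [sq_abs]; linarith
  · linarith

/-- An additive Cauchy–Schwarz inequality: the two summands have product (1 + k²)a² ≥ (wt k · a)²/2,
and 2xy ≤ (x + y)² for nonnegative x, y. The first summand is summable over `k` exactly when s >
3/2, which is where μ > 3/2 enters. -/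
lemma wt_mul_norm_le (s : ℝ) (k : ℤ) (a : ℝ) :
    wt k * a ≤ (1 + (k : ℝ) ^ 2) ^ (-(s - 1)) + (1 + (k : ℝ) ^ 2) ^ s * a ^ 2 := by
  have hpos : 0 < 1 + (k : ℝ) ^ 2 := by positivity
  have h1 : (1 + (k : ℝ) ^ 2) ^ (-(s - 1)) * (1 + (k : ℝ) ^ 2) ^ s = 1 + (k : ℝ) ^ 2 := by
    rw [← Real.rpow_add hpos]; simp
  set p := (1 + (k : ℝ) ^ 2) ^ (-(s - 1)) with hp
  set q := (1 + (k : ℝ) ^ 2) ^ s with hq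
  have hp0 : 0 < p := weight_pos _ k
  have hq0 : 0 < q := weight_pos _ k
  have h2 := wt_sq_le k
  have h3 : (wt k * a) ^ 2 ≤ (p + q * a ^ 2) ^ 2 := by
    have : (wt k * a) ^ 2 ≤ 2 * (p * q) * a ^ 2 := by
      rw [h1, mul_pow]; exact mul_le_mul_of_nonneg_right h2 (sq_nonneg a)
    nlinarith [sq_nonneg p, sq_nonneg (q * a ^ 2), mul_nonneg hp0.le (mul_nonneg hq0.le (sq_nonneg a))]
  exact le_of_abs_le (abs_le_of_sq_le_sq h3 (by positivity))

lemma summable_wt_mul {s : ℝ} (hs : 3 / 2 < s) {c : ℤ → ℝ} (hc : ∀ k, 0 ≤ c k)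
    (h : Summable fun k : ℤ => (1 + (k : ℝ) ^ 2) ^ s * c k ^ 2) :
    Summable fun k => wt k * c k :=
  Summable.of_nonneg_of_le (fun k => mul_nonneg (wt_pos k).le (hc k))
    (fun k => wt_mul_norm_le s k (c k)) ((summable_weight (by linarith)).add h)

lemma tsum_wt_mul_le {s : ℝ} (hs : 3 / 2 < s) {c : ℤ → ℝ} (hc : ∀ k, 0 ≤ c k)
    (h : Summable fun k : ℤ => (1 + (k : ℝ) ^ 2) ^ s * c k ^ 2) :
    ∑' k, wt k * c k ≤ (∑' k : ℤ, (1 + (k : ℝ) ^ 2) ^ (-(s - 1))) +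
      ∑' k : ℤ, (1 + (k : ℝ) ^ 2) ^ s * c k ^ 2 := by
  have h1 := summable_weight (r := s - 1) (by linarith)
  rw [← h1.tsum_add h]
  exact (summable_wt_mul hs hc h).tsum_le_tsum (fun k => wt_mul_norm_le s k (c k)) (h1.add h)

/-- Write 1 + k² = (1 + k²)^{1-s}(1 + k²)^s; the exponent 1 - s is nonpositive and 1 + k² ≥ N² off
the retained frequencies. The convergence rate originates here. -/
lemma tail_weight_le {s : ℝ} (hs : 1 ≤ s) {N : ℕ} (hN : 1 ≤ N) {k : ℤ} (hk : k ∉ freq N) :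
    1 + (k : ℝ) ^ 2 ≤ ((N : ℝ) ^ (1 - s)) ^ 2 * (1 + (k : ℝ) ^ 2) ^ s := by
  have hNp : (0 : ℝ) < N := by exact_mod_cast hN
  have hkN : (N : ℝ) ^ 2 ≤ 1 + (k : ℝ) ^ 2 := by
    have : (N : ℤ) ^ 2 ≤ k ^ 2 := by
      apply sq_le_sq.2
      simp only [freq, Finset.mem_Icc, not_and_or, not_le] at hk
      rw [abs_of_nonneg (by omega)]
      rcases hk with h | h
      · exact le_abs.2 (Or.inr (by omega))
      · exact le_abs.2 (Or.inl (by omega))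
    have h2 : (N : ℝ) ^ 2 ≤ (k : ℝ) ^ 2 := by exact_mod_cast this
    linarith
  have hpos : 0 < 1 + (k : ℝ) ^ 2 := by positivity
  have e1 : ((N : ℝ) ^ (1 - s)) ^ 2 = ((N : ℝ) ^ 2) ^ (1 - s) := by
    rw [← Real.rpow_natCast, ← Real.rpow_natCast, ← Real.rpow_mul hNp.le, ← Real.rpow_mul hNp.le,
      mul_comm]
  have e2 : (1 + (k : ℝ) ^ 2) = (1 + (k : ℝ) ^ 2) ^ (1 - s) * (1 + (k : ℝ) ^ 2) ^ s := by
    rw [← Real.rpow_add hpos]; simp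
  rw [e1]
  nth_rewrite 1 [e2]
  exact mul_le_mul_of_nonneg_right
    (Real.rpow_le_rpow_of_nonpos (by positivity) hkN (by linarith)) (weight_pos _ _).le

/-! ### The exact equations, one Fourier mode at a time -/

/-- The real test function `Re (A e^{-2πikx})`. -/
def testFn (A : ℂ) (k : ℤ) (x : ℝ) : ℝ := (A * expo (-k) x).re

lemma contDiff_testFn (A : ℂ) (k : ℤ) : ContDiff ℝ ∞ (testFn A k) :=
  Complex.reCLM.contDiff.comp (contDiff_const.mul (contDiff_expo (-k)))

lemma periodic_testFn (A : ℂ) (k : ℤ) : Function.Periodic (testFn A k) 1 := fun x => by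
  simp only [testFn, periodic_expo _ x]

lemma deriv_testFn (A : ℂ) (k : ℤ) : deriv (testFn A k) = testFn (A * -sym k) k := by
  ext x
  have h := ((hasDerivAt_expo (-k) x).const_mul A)
  have h2 := (Complex.reCLM.hasFDerivAt (x := A * expo (-k) x)).comp_hasDerivAt x h
  refine Eq.trans (HasDerivAt.deriv h2) ?_
  simp only [testFn, sym_neg, Complex.reCLM_apply]
  congr 1; ring

lemma iteratedDeriv_testFn (A : ℂ) (k : ℤ) (n : ℕ) :
    iteratedDeriv n (testFn A k) = testFn (A * (-sym k) ^ n) k := by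
  induction n generalizing A with
  | zero => simp
  | succ n ih => rw [iteratedDeriv_succ', deriv_testFn, ih]; congr 1; ring

lemma integral_mul_testFn {g : ℝ → ℝ} (hg : IntervalIntegrable g volume 0 1) (A : ℂ) (k : ℤ) :
    ∫ x in (0 : ℝ)..1, g x * testFn A k x = (A * fhat g k).re := by
  have hi : IntervalIntegrable (fun x => A * ((g x : ℂ) * expo (-k) x)) volume 0 1 := by
    have h2 : IntervalIntegrable (fun x => (g x : ℂ)) volume 0 1 := ⟨hg.1.ofReal, hg.2.ofReal⟩
    exact (h2.mul_continuousOn (continuous_expo _).continuousOn).const_mul A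
  rw [fhat, ← intervalIntegral.integral_const_mul]
  have := Complex.reCLM.intervalIntegral_comp_comm hi
  simp only [Complex.reCLM_apply] at this
  rw [← this]
  congr 1; ext x
  rw [testFn, show A * ((g x : ℂ) * expo (-k) x) = (g x : ℂ) * (A * expo (-k) x) by ring,
    Complex.re_ofReal_mul]

/-- Test functions are real, so only real parts are visible; letting the complex amplitude `A` vary
recovers the complex equation. The choice `A = conj X` suffices. -/
lemma eq_zero_of_re_mul {X : ℂ} (h : ∀ A : ℂ, (A * X).re = 0) : X = 0 := by
  have := h ((starRingEnd ℂ) X)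
  rw [mul_comm, Complex.mul_conj, Complex.ofReal_re] at this
  exact Complex.normSq_eq_zero.1 this

lemma intervalIntegrable_mul {f g : ℝ → ℝ} (hf : SqInt f) (hg : SqInt g) :
    IntervalIntegrable (fun x => f x * g x) volume 0 1 := by
  rw [intervalIntegrable_iff_integrableOn_Ioc_of_le zero_le_one]
  exact hf.integrable_mul hg

lemma intervalIntegrable_sqInt {f : ℝ → ℝ} (hf : SqInt f) : IntervalIntegrable f volume 0 1 := by
  rw [intervalIntegrable_iff_integrableOn_Ioc_of_le zero_le_one]
  exact hf.integrable (by norm_num)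

/-- The right-hand side of the `ζ` equation on the Fourier side; `P` stands for the Fourier
coefficient of `ζ u`. -/
def rhsζ (p : BBParams) (k : ℤ) (w P : ℂ) : ℂ :=
  -(p.κ₁ * sym k + p.a * sym k ^ 3) * w - p.lam * sym k * P

/-- The right-hand side of the `u` equation on the Fourier side; `P` stands for the Fourier
coefficient of `u²`. -/
def rhsu (p : BBParams) (k : ℤ) (z P : ℂ) : ℂ :=
  (-p.κ₂ * sym k * z - p.lam * sym k * P / 2) / (1 - p.d * sym k ^ 2)

lemma sym_sq (k : ℤ) : sym k ^ 2 = ((-(2 * Real.pi * k) ^ 2 : ℝ) : ℂ) := by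
  rw [sym]; push_cast; ring_nf; rw [Complex.I_sq]; ring

lemma one_sub_mul_sym_sq_ne {d : ℝ} (hd : 0 < d) (k : ℤ) : 1 - (d : ℂ) * sym k ^ 2 ≠ 0 := by
  rw [sym_sq]
  have : (1 : ℂ) - d * ((-(2 * Real.pi * k) ^ 2 : ℝ) : ℂ)
      = ((1 + d * (2 * Real.pi * k) ^ 2 : ℝ) : ℂ) := by push_cast; ring
  rw [this]
  exact_mod_cast (by positivity : (0:ℝ) < 1 + d * (2 * Real.pi * k) ^ 2).ne'

/-- Testing with `testFn A k` for every `A` isolates mode `k`. The u equation is then divided by 1 -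
d·sym², which equals 1 + dω² > 0. -/
lemma IsSolution.modal {p : BBParams} (hvi : p.CaseVI) {s T : ℝ} (hs : 0 ≤ s) {ζ₀ u₀ : ℝ → ℝ}
    {ζ u : ℝ → ℝ → ℝ} (h : IsSolution p s T ζ₀ u₀ ζ u) {t : ℝ} (ht : t ∈ Icc 0 T) (k : ℤ) :
    HasDerivWithinAt (fun r => fhat (ζ r) k)
        (rhsζ p k (fhat (u t) k) (fhat (fun x => ζ t x * u t x) k)) (Icc 0 T) t ∧
      HasDerivWithinAt (fun r => fhat (u r) k)
        (rhsu p k (fhat (ζ t) k) (fhat (fun x => u t x * u t x) k)) (Icc 0 T) t := by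
  obtain ⟨-, -, ζt, ut, hζ, hu, heq⟩ := h
  obtain ⟨hb, hd, ha, hc⟩ := hvi
  have iζ := (hζ.mem t ht).memLp
  have iu := (hu.mem t ht).memLp
  have iζt := (hζ.mem_deriv t ht).memLp
  have iut := (hu.mem_deriv t ht).memLp
  have hc' : p.c' = 0 := by rw [BBParams.c', hc, mul_zero]
  have isq : IntervalIntegrable (fun x => u t x ^ 2 / 2) volume 0 1 := by
    simpa only [sq] using (intervalIntegrable_mul iu iu).div_const 2
  have esq : fhat (fun x => u t x ^ 2 / 2) k = fhat (fun x => u t x * u t x) k / 2 := by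
    have := fhat_div (f := fun x => u t x * u t x) 2 k
    simpa only [sq, Complex.ofReal_ofNat] using this
  have key : ∀ A : ℂ, _ := fun A => heq t ht (testFn A k) (contDiff_testFn A k) (periodic_testFn A k)
  simp only [hb, hc', zero_mul, sub_zero, deriv_testFn, iteratedDeriv_testFn,
    integral_mul_testFn (intervalIntegrable_sqInt iζt), integral_mul_testFn (intervalIntegrable_sqInt iut),
    integral_mul_testFn (intervalIntegrable_sqInt iu), integral_mul_testFn (intervalIntegrable_sqInt iζ),
    integral_mul_testFn (intervalIntegrable_mul iζ iu), integral_mul_testFn isq, esq] at key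
  have k1 : fhat (ζt t) k + p.κ₁ * sym k * fhat (u t) k
      + p.lam * sym k * fhat (fun x => ζ t x * u t x) k + p.a * sym k ^ 3 * fhat (u t) k = 0 := by
    apply eq_zero_of_re_mul
    intro A
    have := (key A).1
    simp only [← Complex.re_ofReal_mul, ← Complex.sub_re] at this
    rw [← this]; congr 1; ring
  have k2 : fhat (ut t) k + p.κ₂ * sym k * fhat (ζ t) k
      + p.lam * sym k * (fhat (fun x => u t x * u t x) k / 2) - p.d * sym k ^ 2 * fhat (ut t) k = 0 := by
    apply eq_zero_of_re_mul
    intro A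
    have := (key A).2
    simp only [← Complex.re_ofReal_mul, ← Complex.sub_re] at this
    rw [← this]; congr 1; ring
  constructor
  · convert hζ.hasDerivWithinAt_fhat hs ht k using 1
    rw [rhsζ]; linear_combination -k1
  · convert hu.hasDerivWithinAt_fhat hs ht k using 1
    rw [rhsu, div_eq_iff (one_sub_mul_sym_sq_ne hd k)]; linear_combination -k2

/-! ### The semidiscrete problem on the Fourier side -/

/-- The discrete convolution of the semidiscrete problem. -/
def dconv (N : ℕ) (z w : ℤ → ℂ) (k : ℤ) : ℂ := ∑ j ∈ freq N, z j * w (k - j)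

/-- `z, w` are the Fourier coefficients of a solution of the semidiscrete problem. -/
structure IsModal (p : BBParams) (T : ℝ) (N : ℕ) (ζ₀ u₀ : ℝ → ℝ) (z w : ℝ → ℤ → ℂ) : Prop where
  supp_z : ∀ t ∈ Icc 0 T, ∀ k ∉ freq N, z t k = 0
  supp_w : ∀ t ∈ Icc 0 T, ∀ k ∉ freq N, w t k = 0
  conj_z : ∀ t ∈ Icc 0 T, ∀ k, z t (-k) = (starRingEnd ℂ) (z t k)
  conj_w : ∀ t ∈ Icc 0 T, ∀ k, w t (-k) = (starRingEnd ℂ) (w t k)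
  init_z : ∀ k ∈ freq N, z 0 k = fhat ζ₀ k
  init_w : ∀ k ∈ freq N, w 0 k = fhat u₀ k
  deriv_z : ∀ t ∈ Icc 0 T, ∀ k ∈ freq N, HasDerivWithinAt (fun r => z r k)
    (rhsζ p k (w t k) (dconv N (z t) (w t) k)) (Icc 0 T) t
  deriv_w : ∀ t ∈ Icc 0 T, ∀ k ∈ freq N, HasDerivWithinAt (fun r => w r k)
    (rhsu p k (z t k) (dconv N (w t) (w t) k)) (Icc 0 T) t

lemma fhat_mul_of_mem {N : ℕ} {f g : ℝ → ℝ} (hf : toC f ∈ trigSpace N) (hg : Continuous g)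
    (k : ℤ) : fhat (fun x => f x * g x) k = dconv N (fhat f) (fhat g) k := by
  have h := coeff_trig_mul (freq N) (fhat f) (G := toC g)
    (Complex.continuous_ofReal.comp hg) k
  rw [dconv]
  refine Eq.trans ?_ h
  rw [← eq_trig_of_mem hf, fhat_eq_coeff]
  congr 1; ext x; simp [toC]

/-- Sampling at the points `j / (2N+1)` recovers the coefficients of a trigonometric polynomial. -/
lemma sum_expo_sample {N : ℕ} {k : ℤ} (hk : |k| ≤ 2 * N) :
    ∑ j ∈ Finset.range (2 * N + 1), expo k ((j : ℝ) / (2 * N + 1)) =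
      if k = 0 then (2 * N + 1 : ℂ) else 0 := by
  have hM : (2 * (N : ℂ) + 1) ≠ 0 := by exact_mod_cast (by omega : 2 * N + 1 ≠ 0)
  split_ifs with h0
  · subst h0; simp [expo_zero]
  · set q := Complex.exp (sym k / (2 * N + 1)) with hq
    have h1 : ∀ j : ℕ, expo k ((j : ℝ) / (2 * N + 1)) = q ^ j := fun j => by
      rw [hq, ← Complex.exp_nat_mul, expo_eq]; congr 1; push_cast; field_simp
    simp only [h1]
    have hqM : q ^ (2 * N + 1) = 1 := by
      rw [hq, ← Complex.exp_nat_mul, Complex.exp_eq_one_iff]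
      refine ⟨k, ?_⟩
      rw [sym]; push_cast; field_simp
    -- `q = 1` would make 2N + 1 divide `k`, impossible for 0 < |k| ≤ 2N.
    have hq1 : q ≠ 1 := by
      intro h
      rw [hq, Complex.exp_eq_one_iff] at h
      obtain ⟨n, hn⟩ := h
      have hpi : (2 * Real.pi * Complex.I : ℂ) ≠ 0 := by simp [Real.pi_ne_zero]
      have h2 : (k : ℂ) = n * (2 * N + 1) := by
        rw [sym, div_eq_iff hM] at hn
        apply mul_left_cancel₀ hpi
        linear_combination hn
      have h3 : k = n * (2 * N + 1) := by exact_mod_cast h2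
      have hn0 : n ≠ 0 := by rintro rfl; simp at h3; exact h0 h3
      have h4 : 1 ≤ |n| := Int.one_le_abs hn0
      rw [h3, abs_mul, abs_of_nonneg (by positivity : (0 : ℤ) ≤ 2 * N + 1)] at hk
      nlinarith
    have := geom_sum_mul q (2 * N + 1)
    rw [hqM, sub_self] at this
    exact (mul_eq_zero.1 this).resolve_right (sub_ne_zero.2 hq1)

/-- Differences of retained frequencies are at most 2N in modulus, so 2N + 1 sample points separate
them. Coefficients thus become finite linear combinations of point values, and pointwise
differentiability in time transfers to them. -/
lemma coeff_eq_sample {N : ℕ} (c : ℤ → ℂ) {k : ℤ} (hk : k ∈ freq N) :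
    c k = (2 * N + 1 : ℂ)⁻¹ * ∑ j ∈ Finset.range (2 * N + 1),
      trig (freq N) c ((j : ℝ) / (2 * N + 1)) * expo (-k) ((j : ℝ) / (2 * N + 1)) := by
  have hM : (2 * (N : ℂ) + 1) ≠ 0 := by exact_mod_cast (by omega : 2 * N + 1 ≠ 0)
  have h1 : ∀ x, trig (freq N) c x * expo (-k) x = ∑ l ∈ freq N, c l * expo (l - k) x := by
    intro x
    rw [trig, Finset.sum_mul]
    exact Finset.sum_congr rfl fun l _ => by rw [sub_eq_add_neg, expo_add]; ring
  simp only [h1]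
  rw [Finset.sum_comm]
  simp only [← Finset.mul_sum]
  have h2 : ∀ l ∈ freq N, c l * ∑ j ∈ Finset.range (2 * N + 1), expo (l - k) ((j : ℝ) / (2 * N + 1))
      = if l = k then c k * (2 * N + 1) else 0 := by
    intro l hl
    simp only [freq, Finset.mem_Icc] at hk hl
    rw [sum_expo_sample (abs_le.2 ⟨by omega, by omega⟩)]
    by_cases h : l = k
    · simp [h]
    · simp [h, sub_ne_zero.2 h]
  rw [Finset.sum_congr rfl h2, Finset.sum_ite_eq' , if_pos hk]
  field_simp

/-- A family in `S_N` that is differentiable at each point has a derivative in `S_N`, and its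
Fourier coefficients are differentiable. -/
lemma hasDerivWithinAt_fhat_of_mem {N : ℕ} {T : ℝ} (hT : 0 < T) {f : ℝ → ℝ → ℝ} {f' : ℝ → ℝ}
    (hf : ∀ t ∈ Icc 0 T, toC (f t) ∈ trigSpace N) {t : ℝ} (ht : t ∈ Icc 0 T)
    (hd : ∀ x, HasDerivWithinAt (fun r => f r x) (f' x) (Icc 0 T) t) :
    toC f' ∈ trigSpace N ∧
      ∀ k, HasDerivWithinAt (fun r => fhat (f r) k) (fhat f' k) (Icc 0 T) t := by
  have hdC : ∀ x, HasDerivWithinAt (fun r => toC (f r) x) (toC f' x) (Icc 0 T) t :=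
    fun x => (hd x).ofReal_comp
  set c' : ℤ → ℂ := fun k => (2 * N + 1 : ℂ)⁻¹ * ∑ j ∈ Finset.range (2 * N + 1),
      toC f' ((j : ℝ) / (2 * N + 1)) * expo (-k) ((j : ℝ) / (2 * N + 1)) with hc'
  have hc : ∀ k ∈ freq N, HasDerivWithinAt (fun r => fhat (f r) k) (c' k) (Icc 0 T) t := by
    intro k hk
    have h1 : HasDerivWithinAt (fun r => (2 * N + 1 : ℂ)⁻¹ * ∑ j ∈ Finset.range (2 * N + 1),
        toC (f r) ((j : ℝ) / (2 * N + 1)) * expo (-k) ((j : ℝ) / (2 * N + 1))) (c' k) (Icc 0 T) t := by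
      apply HasDerivWithinAt.const_mul
      apply HasDerivWithinAt.fun_sum
      intro j _
      exact (hdC _).mul_const _
    refine h1.congr_of_mem (fun r hr => ?_) ht
    rw [eq_trig_of_mem (hf r hr)]
    exact coeff_eq_sample _ hk
  have hmem : toC f' = trig (freq N) c' := by
    ext x
    have h1 : HasDerivWithinAt (fun r => trig (freq N) (fhat (f r)) x) (trig (freq N) c' x)
        (Icc 0 T) t := by
      unfold trig
      apply HasDerivWithinAt.fun_sum
      intro k hk
      exact (hc k hk).mul_const _
    have h2 : HasDerivWithinAt (fun r => trig (freq N) (fhat (f r)) x) (toC f' x) (Icc 0 T) t := by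
      refine (hdC x).congr_of_mem (fun r hr => ?_) ht
      rw [← eq_trig_of_mem (hf r hr)]
    exact (uniqueDiffOn_Icc hT t ht).eq_deriv _ h2 h1
  have hmem' : toC f' ∈ trigSpace N := hmem ▸ trig_mem_trigSpace N c'
  refine ⟨hmem', fun k => ?_⟩
  by_cases hk : k ∈ freq N
  · convert hc k hk using 1
    rw [fhat_eq_coeff, hmem, coeff_trig, if_pos hk]
  · rw [fhat_eq_zero_of_mem hmem' hk]
    refine (hasDerivWithinAt_const t _ (0 : ℂ)).congr_of_mem (fun r hr => ?_) ht
    exact fhat_eq_zero_of_mem (hf r hr) hk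

/-- The weak form of the `ζ` equation of the semidiscrete problem, one mode at a time. -/
lemma galerkinζ_expo {p : BBParams} {N : ℕ} {f g f' : ℝ → ℝ} (hb : p.b = 0)
    (hf : toC f ∈ trigSpace N) (hg : toC g ∈ trigSpace N) (k : ℤ) :
    ip (toC f') (expo k) + p.κ₁ * ip (toC (deriv g)) (expo k)
        + p.lam * ip (toC (deriv fun x => f x * g x)) (expo k)
        + p.a * ip (toC (iteratedDeriv 3 g)) (expo k)
        - p.b * ip (toC (iteratedDeriv 2 f')) (expo k) =
      fhat f' k - rhsζ p k (fhat g k) (dconv N (fhat f) (fhat g) k) := by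
  have cf := contDiff_of_mem hf
  have cg := contDiff_of_mem hg
  have pf := periodic_of_mem hf
  have pg := periodic_of_mem hg
  have e3 := fhat_deriv ((cf.mul cg).of_le (by simp)) (fun x => by simp only [pf x, pg x]) k
  simp only [ip_expo, ← fhat_eq_coeff]
  rw [fhat_deriv (cg.of_le (by simp)) pg, e3, fhat_mul_of_mem hf cg.continuous,
    fhat_iteratedDeriv cg pg, hb, rhsζ]
  push_cast; ring

/-- The u u_x term is half the derivative of u². The prefactor on the right never vanishes, so the
Galerkin residual is zero exactly when the modal equation holds. -/
lemma galerkinu_expo {p : BBParams} {N : ℕ} {f g g' : ℝ → ℝ} (hd : 0 < p.d) (hc : p.c' = 0)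
    (hf : toC f ∈ trigSpace N) (hg : toC g ∈ trigSpace N) (hg' : toC g' ∈ trigSpace N) (k : ℤ) :
    ip (toC g') (expo k) + p.κ₂ * ip (toC (deriv f)) (expo k)
        + p.lam * ip (toC fun x => g x * deriv g x) (expo k)
        + p.c' * ip (toC (iteratedDeriv 3 f)) (expo k)
        - p.d * ip (toC (iteratedDeriv 2 g')) (expo k) =
      (1 - p.d * sym k ^ 2) * (fhat g' k - rhsu p k (fhat f k) (dconv N (fhat g) (fhat g) k)) := by
  have cf := contDiff_of_mem hf
  have cg := contDiff_of_mem hg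
  have pf := periodic_of_mem hf
  have pg := periodic_of_mem hg
  have e3 : fhat (fun x => g x * deriv g x) k = sym k * dconv N (fhat g) (fhat g) k / 2 := by
    have h1 := fhat_deriv ((cg.mul cg).of_le (by simp)) (fun x => by simp only [pg x]) k
    rw [fhat_mul_of_mem hg cg.continuous] at h1
    have h2 : (fun x => g x * deriv g x) = fun x => deriv (fun x => g x * g x) x / 2 := by
      ext x
      have hx := (cg.differentiable (by simp) x)
      rw [deriv_fun_mul hx hx]; ring
    rw [h2, fhat_div]
    rw [show fhat (fun x => deriv (fun x => g x * g x) x) k = _ from h1]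
    push_cast; rfl
  simp only [ip_expo, ← fhat_eq_coeff]
  rw [fhat_deriv (cf.of_le (by simp)) pf, e3, hc, fhat_iteratedDeriv (contDiff_of_mem hg')
    (periodic_of_mem hg'), rhsu, mul_sub, mul_div_cancel₀ _ (one_sub_mul_sym_sq_ne hd k)]
  push_cast; ring

lemma coeff_proj {N : ℕ} (g : ℝ → ℝ) {k : ℤ} (hk : k ∈ freq N) :
    coeff (proj N g) k = fhat g k := by
  have : proj N g = trig (freq N) (fhat g) := rfl
  rw [this, coeff_trig, if_pos hk]

lemma expo_mem_trigSpace {N : ℕ} {k : ℤ} (hk : k ∈ freq N) : expo k ∈ trigSpace N :=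
  Submodule.subset_span ⟨k, by simpa using hk, rfl⟩

lemma IsSemidiscrete.isModal {p : BBParams} (hvi : p.CaseVI) {T : ℝ} (hT : 0 < T) {N : ℕ}
    {ζ₀ u₀ : ℝ → ℝ} {ζN uN : ℝ → ℝ → ℝ} (h : IsSemidiscrete p T N ζ₀ u₀ ζN uN) :
    IsModal p T N ζ₀ u₀ (fun t => fhat (ζN t)) (fun t => fhat (uN t)) := by
  obtain ⟨hb, hd, ha, hc⟩ := hvi
  have hc' : p.c' = 0 := by rw [BBParams.c', hc, mul_zero]
  refine ⟨fun t ht k hk => fhat_eq_zero_of_mem (h.mem_ζ t ht) hk,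
    fun t ht k hk => fhat_eq_zero_of_mem (h.mem_u t ht) hk, fun t _ k => fhat_neg _ k,
    fun t _ k => fhat_neg _ k, fun k hk => ?_, fun k hk => ?_, fun t ht k hk => ?_,
    fun t ht k hk => ?_⟩
  · rw [fhat_eq_coeff, h.init_ζ, coeff_proj _ hk]
  · rw [fhat_eq_coeff, h.init_u, coeff_proj _ hk]
  · obtain ⟨ζt, ut, h1, h2, h3, h4⟩ := h.galerkin t ht
    obtain ⟨m1, d1⟩ := hasDerivWithinAt_fhat_of_mem hT h.mem_ζ ht h1
    have := h3 _ (expo_mem_trigSpace hk)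
    rw [galerkinζ_expo hb (h.mem_ζ t ht) (h.mem_u t ht), sub_eq_zero] at this
    rw [← this]; exact d1 k
  · obtain ⟨ζt, ut, h1, h2, h3, h4⟩ := h.galerkin t ht
    obtain ⟨m2, d2⟩ := hasDerivWithinAt_fhat_of_mem hT h.mem_u ht h2
    have := h4 _ (expo_mem_trigSpace hk)
    rw [galerkinu_expo hd hc' (h.mem_ζ t ht) (h.mem_u t ht) m2,
      mul_eq_zero_iff_left (one_sub_mul_sym_sq_ne hd k), sub_eq_zero] at this
    rw [← this]; exact d2 k

/-- Conjugate linearity in the second slot reduces testing against all of S_N to testing against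
exponentials. -/
lemma ip_trig {F : ℝ → ℂ} (hF : Continuous F) (s : Finset ℤ) (c : ℤ → ℂ) :
    ip F (trig s c) = ∑ k ∈ s, (starRingEnd ℂ) (c k) * ip F (expo k) := by
  simp only [ip, ← intervalIntegral.integral_const_mul]
  rw [← intervalIntegral.integral_finsetSum]
  · congr 1; ext x
    simp only [trig, map_sum, map_mul, Finset.mul_sum]
    exact Finset.sum_congr rfl fun k _ => by ring
  · intro k _
    have := continuous_expo k
    exact Continuous.intervalIntegrable (by fun_prop) _ _

lemma continuous_toC {f : ℝ → ℝ} (hf : Continuous f) : Continuous (toC f) :=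
  Complex.continuous_ofReal.comp hf

lemma continuous_iteratedDeriv_of_mem {N : ℕ} {f : ℝ → ℝ} (hf : toC f ∈ trigSpace N) (n : ℕ) :
    Continuous (iteratedDeriv n f) :=
  (contDiff_of_mem hf).continuous_iteratedDeriv n (by exact_mod_cast le_top)

lemma continuous_deriv_of_contDiff {f : ℝ → ℝ} (hf : ContDiff ℝ ∞ f) : Continuous (deriv f) :=
  hf.continuous_deriv (by simp)

lemma IsModal.isSemidiscrete {p : BBParams} (hvi : p.CaseVI) {T : ℝ} (hT : 0 < T) {N : ℕ}
    {ζ₀ u₀ : ℝ → ℝ} {z w : ℝ → ℤ → ℂ} (h : IsModal p T N ζ₀ u₀ z w) :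
    IsSemidiscrete p T N ζ₀ u₀ (fun t x => (trig (freq N) (z t) x).re)
      (fun t x => (trig (freq N) (w t) x).re) := by
  obtain ⟨hb, hd, ha, hc⟩ := hvi
  have hc' : p.c' = 0 := by rw [BBParams.c', hc, mul_zero]
  have h0 : (0 : ℝ) ∈ Icc 0 T := ⟨le_rfl, hT.le⟩
  have ez : ∀ t ∈ Icc 0 T, toC (fun x => (trig (freq N) (z t) x).re) = trig (freq N) (z t) :=
    fun t ht => toC_re_trig (h.conj_z t ht)
  have ew : ∀ t ∈ Icc 0 T, toC (fun x => (trig (freq N) (w t) x).re) = trig (freq N) (w t) :=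
    fun t ht => toC_re_trig (h.conj_w t ht)
  have mz : ∀ t ∈ Icc 0 T, toC (fun x => (trig (freq N) (z t) x).re) ∈ trigSpace N :=
    fun t ht => by rw [ez t ht]; exact trig_mem_trigSpace _ _
  have mw : ∀ t ∈ Icc 0 T, toC (fun x => (trig (freq N) (w t) x).re) ∈ trigSpace N :=
    fun t ht => by rw [ew t ht]; exact trig_mem_trigSpace _ _
  have fz : ∀ t ∈ Icc 0 T, fhat (fun x => (trig (freq N) (z t) x).re) = z t := fun t ht => by
    ext k
    rw [fhat_eq_coeff, ez t ht, coeff_trig]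
    split_ifs with hk
    · rfl
    · rw [h.supp_z t ht k hk]
  have fw : ∀ t ∈ Icc 0 T, fhat (fun x => (trig (freq N) (w t) x).re) = w t := fun t ht => by
    ext k
    rw [fhat_eq_coeff, ew t ht, coeff_trig]
    split_ifs with hk
    · rfl
    · rw [h.supp_w t ht k hk]
  refine ⟨mz, mw, ?_, ?_, fun t ht => ?_⟩
  · rw [ez 0 h0]; ext x
    exact Finset.sum_congr rfl fun k hk => by rw [h.init_z k hk]
  · rw [ew 0 h0]; ext x
    exact Finset.sum_congr rfl fun k hk => by rw [h.init_w k hk]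
  · have dz : ∀ x, HasDerivWithinAt (fun r => (trig (freq N) (z r) x).re)
        (trig (freq N) (fun k => rhsζ p k (w t k) (dconv N (z t) (w t) k)) x).re (Icc 0 T) t := by
      intro x
      have : HasDerivWithinAt (fun r => trig (freq N) (z r) x)
          (trig (freq N) (fun k => rhsζ p k (w t k) (dconv N (z t) (w t) k)) x) (Icc 0 T) t := by
        unfold trig
        exact HasDerivWithinAt.fun_sum fun k hk => (h.deriv_z t ht k hk).mul_const _
      exact (Complex.reCLM.hasFDerivAt.comp_hasDerivWithinAt t this)
    have dw : ∀ x, HasDerivWithinAt (fun r => (trig (freq N) (w r) x).re)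
        (trig (freq N) (fun k => rhsu p k (z t k) (dconv N (w t) (w t) k)) x).re (Icc 0 T) t := by
      intro x
      have : HasDerivWithinAt (fun r => trig (freq N) (w r) x)
          (trig (freq N) (fun k => rhsu p k (z t k) (dconv N (w t) (w t) k)) x) (Icc 0 T) t := by
        unfold trig
        exact HasDerivWithinAt.fun_sum fun k hk => (h.deriv_w t ht k hk).mul_const _
      exact (Complex.reCLM.hasFDerivAt.comp_hasDerivWithinAt t this)
    refine ⟨_, _, dz, dw, ?_, ?_⟩
    · obtain ⟨m1, d1⟩ := hasDerivWithinAt_fhat_of_mem hT mz ht dz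
      intro φ hφ
      obtain ⟨c, rfl⟩ := exists_trig_of_mem hφ
      have cz := contDiff_of_mem (mz t ht)
      have cw := contDiff_of_mem (mw t ht)
      rw [hb, Complex.ofReal_zero, zero_mul, sub_zero,
        ip_trig (continuous_toC (contDiff_of_mem m1).continuous),
        ip_trig (continuous_toC (continuous_deriv_of_contDiff cw)),
        ip_trig (continuous_toC (continuous_deriv_of_contDiff (cz.mul cw))),
        ip_trig (continuous_toC (continuous_iteratedDeriv_of_mem (mw t ht) 3))]
      simp only [Finset.mul_sum, ← Finset.sum_add_distrib]
      refine Finset.sum_eq_zero fun k hk => ?_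
      have g := galerkinζ_expo hb (mz t ht) (mw t ht)
        (f' := fun x => (trig (freq N) (fun k => rhsζ p k (w t k) (dconv N (z t) (w t) k)) x).re) k
      -- Both values are derivatives of the same coefficient within [0,T], and such derivatives are
      -- unique because `0 < T`.
      have : fhat (fun x => (trig (freq N) (fun k => rhsζ p k (w t k) (dconv N (z t) (w t) k)) x).re) k
          = rhsζ p k (w t k) (dconv N (z t) (w t) k) := by
        refine (uniqueDiffOn_Icc hT t ht).eq_deriv _ (d1 k) ?_
        refine (h.deriv_z t ht k hk).congr_of_mem (fun r hr => ?_) ht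
        rw [fz r hr]
      rw [this, fz t ht, fw t ht, sub_self, hb, Complex.ofReal_zero, zero_mul, sub_zero] at g
      linear_combination (starRingEnd ℂ) (c k) * g
    · obtain ⟨m2, d2⟩ := hasDerivWithinAt_fhat_of_mem hT mw ht dw
      intro φ hφ
      obtain ⟨c, rfl⟩ := exists_trig_of_mem hφ
      have cz := contDiff_of_mem (mz t ht)
      have cw := contDiff_of_mem (mw t ht)
      rw [hc', Complex.ofReal_zero, zero_mul, add_zero,
        ip_trig (continuous_toC (contDiff_of_mem m2).continuous),
        ip_trig (continuous_toC (continuous_deriv_of_contDiff cz)),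
        ip_trig (F := toC fun x => (trig (freq N) (w t) x).re * deriv (fun x => (trig (freq N) (w t) x).re) x)
          (continuous_toC (cw.continuous.mul (continuous_deriv_of_contDiff cw))),
        ip_trig (continuous_toC (continuous_iteratedDeriv_of_mem m2 2))]
      simp only [Finset.mul_sum, ← Finset.sum_add_distrib, ← Finset.sum_sub_distrib]
      refine Finset.sum_eq_zero fun k hk => ?_
      have g := galerkinu_expo hd hc' (mz t ht) (mw t ht) m2 k
      have : fhat (fun x => (trig (freq N) (fun k => rhsu p k (z t k) (dconv N (w t) (w t) k)) x).re) k
          = rhsu p k (z t k) (dconv N (w t) (w t) k) := by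
        refine (uniqueDiffOn_Icc hT t ht).eq_deriv _ (d2 k) ?_
        refine (h.deriv_w t ht k hk).congr_of_mem (fun r hr => ?_) ht
        rw [fw r hr]
      rw [this, fz t ht, fw t ht, sub_self, mul_zero, hc', Complex.ofReal_zero, zero_mul, add_zero] at g
      linear_combination (starRingEnd ℂ) (c k) * g

/-! ### Weighted sequences and convolutions -/

lemma summable_mul_shift {b q : ℤ → ℝ} (hb : ∀ k, 0 ≤ b k) (hq : ∀ k, 0 ≤ q k)
    (hbs : Summable b) (hqs : Summable q) (k : ℤ) : Summable fun j => b j * q (k - j) :=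
  Summable.of_nonneg_of_le (fun j => mul_nonneg (hb j) (hq _))
    (fun j => mul_le_mul_of_nonneg_left (hqs.le_tsum (k - j) fun i _ => hq i) (hb j))
    (hbs.mul_right _)

lemma summable_sq {b : ℤ → ℝ} (hb : ∀ k, 0 ≤ b k) (hbs : Summable b) :
    Summable fun j => b j ^ 2 :=
  Summable.of_nonneg_of_le (fun j => sq_nonneg _)
    (fun j => by
      rw [sq]; exact mul_le_mul_of_nonneg_left (hbs.le_tsum j fun i _ => hb i) (hb j))
    (hbs.mul_right _)

lemma tsum_shift {E : Type*} [AddCommGroup E] [TopologicalSpace E] (q : ℤ → E)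
    (k : ℤ) : ∑' j, q (k - j) = ∑' j, q j :=
  (Equiv.subLeft k).tsum_eq q

lemma sum_shift_le {q : ℤ → ℝ} (hq : ∀ k, 0 ≤ q k) (hqs : Summable q) (s : Finset ℤ) (j : ℤ) :
    ∑ k ∈ s, q (k - j) ≤ ∑' k, q k := by
  have h1 : Summable fun k => q (k - j) := hqs.comp_injective (Equiv.subRight j).injective
  refine (h1.sum_le_tsum s fun k _ => hq _).trans_eq ?_
  exact (Equiv.subRight j).tsum_eq q

/-- Schur's test for a convolution operator. -/
lemma schur (s : Finset ℤ) {a b q : ℤ → ℝ} (hb : ∀ k, 0 ≤ b k)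
    (hq : ∀ k, 0 ≤ q k) (hbs : Summable b) (hqs : Summable q) :
    ∑ k ∈ s, a k * ∑' j, b j * q (k - j) ≤
      (∑' k, q k) / 2 * (∑ k ∈ s, a k ^ 2 + ∑' k, b k ^ 2) := by
  have hb2 : Summable fun j => b j ^ 2 := summable_sq hb hbs
  have hs2 : ∀ k, Summable fun j => b j ^ 2 * q (k - j) :=
    summable_mul_shift (fun j => sq_nonneg _) hq hb2 hqs
  have hs1 : ∀ k, Summable fun j => q (k - j) := fun k =>
    hqs.comp_injective (Equiv.subLeft k).injective
  -- Young's inequality a_k b_j ≤ (a_k² + b_j²)/2 under the kernel q(k - j); each half is then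
  -- summed over the index it does not contain.
  have h1 : ∀ k ∈ s, a k * ∑' j, b j * q (k - j) ≤
      a k ^ 2 / 2 * (∑' j, q j) + (∑' j, b j ^ 2 * q (k - j)) / 2 := by
    intro k _
    rw [← tsum_mul_left, ← tsum_shift q k, ← tsum_mul_left, ← tsum_div_const,
      ← ((hs1 k).mul_left _).tsum_add ((hs2 k).div_const 2)]
    refine ((summable_mul_shift hb hq hbs hqs k).mul_left _).tsum_le_tsum (fun j => ?_)
      (((hs1 k).mul_left _).add ((hs2 k).div_const 2))
    nlinarith [mul_nonneg (sq_nonneg (a k - b j)) (hq (k - j))]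
  refine (Finset.sum_le_sum h1).trans ?_
  rw [Finset.sum_add_distrib, ← Finset.sum_mul, ← Finset.sum_div, ← Finset.sum_div,
    ← Summable.tsum_finsetSum fun k _ => hs2 k]
  have h2 : ∑' j, ∑ k ∈ s, b j ^ 2 * q (k - j) ≤ (∑' j, b j ^ 2) * ∑' k, q k := by
    rw [← tsum_mul_right]
    refine (summable_sum fun k _ => hs2 k).tsum_le_tsum (fun j => ?_) (hb2.mul_right _)
    rw [← Finset.mul_sum]
    exact mul_le_mul_of_nonneg_left (sum_shift_le hq hqs s j) (sq_nonneg _)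
  linarith

/-- Summability with the weight `1 + |k|`. -/
def Wsum (f : ℤ → ℂ) : Prop := Summable fun k => wt k * ‖f k‖

/-- The `ℓ¹` norm with the weight `1 + |k|`. -/
def wnorm (f : ℤ → ℂ) : ℝ := ∑' k, wt k * ‖f k‖

lemma wt_mul_norm_nonneg (f : ℤ → ℂ) (k : ℤ) : 0 ≤ wt k * ‖f k‖ :=
  mul_nonneg (wt_pos k).le (norm_nonneg _)

lemma Wsum.of_le {f g : ℤ → ℂ} (hg : Wsum g) (h : ∀ k, ‖f k‖ ≤ ‖g k‖) : Wsum f :=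
  Summable.of_nonneg_of_le (wt_mul_norm_nonneg f)
    (fun k => mul_le_mul_of_nonneg_left (h k) (wt_pos k).le) hg

lemma Wsum.add {f g : ℤ → ℂ} (hf : Wsum f) (hg : Wsum g) : Wsum (f + g) := by
  refine Summable.of_nonneg_of_le (wt_mul_norm_nonneg _) (fun k => ?_) (Summable.add hf hg)
  rw [← mul_add]
  exact mul_le_mul_of_nonneg_left (norm_add_le _ _) (wt_pos k).le

lemma wnorm_add_le {f g : ℤ → ℂ} (hf : Wsum f) (hg : Wsum g) :
    wnorm (f + g) ≤ wnorm f + wnorm g := by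
  rw [wnorm, wnorm, wnorm, ← Summable.tsum_add hf hg]
  refine Summable.tsum_le_tsum (fun k => ?_) (hf.add hg) (Summable.add hf hg)
  rw [← mul_add]
  exact mul_le_mul_of_nonneg_left (norm_add_le _ _) (wt_pos k).le

lemma wnorm_mono {f g : ℤ → ℂ} (hg : Wsum g) (h : ∀ k, ‖f k‖ ≤ ‖g k‖) : wnorm f ≤ wnorm g :=
  Summable.tsum_le_tsum (fun k => mul_le_mul_of_nonneg_left (h k) (wt_pos k).le) (hg.of_le h) hg

lemma Wsum.of_support {N : ℕ} {f : ℤ → ℂ} (h : ∀ k ∉ freq N, f k = 0) : Wsum f :=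
  summable_of_ne_finset_zero (s := freq N) fun k hk => by rw [h k hk]; simp

lemma Wsum.summable_mul {f g : ℤ → ℂ} (hf : Wsum f) (hg : Wsum g) (k : ℤ) :
    Summable fun j => f j * g (k - j) := by
  refine Summable.of_norm_bounded (summable_mul_shift (wt_mul_norm_nonneg f) (wt_mul_norm_nonneg g)
    hf hg k) fun j => ?_
  rw [norm_mul]
  exact mul_le_mul (le_mul_of_one_le_left (norm_nonneg _) (one_le_wt _))
    (le_mul_of_one_le_left (norm_nonneg _) (one_le_wt _)) (norm_nonneg _) (wt_mul_norm_nonneg f j)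

/-- The convolution of two sequences. -/
def conv (f g : ℤ → ℂ) (k : ℤ) : ℂ := ∑' j, f j * g (k - j)

lemma conv_comm (f g : ℤ → ℂ) (k : ℤ) : conv f g k = conv g f k := by
  rw [conv, ← tsum_shift _ k, conv]
  congr 1; ext j; rw [sub_sub_cancel, mul_comm]

lemma conv_eq_dconv {N : ℕ} {f : ℤ → ℂ} (h : ∀ k ∉ freq N, f k = 0) (g : ℤ → ℂ) (k : ℤ) :
    conv f g k = dconv N f g k :=
  tsum_eq_sum fun j hj => by rw [h j hj, zero_mul]

/-- The weight is submultiplicative along k = j + (k - j), so it distributes over the two factors of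
a convolution. -/
lemma wt_mul_conv_le {f g : ℤ → ℂ} (hf : Wsum f) (hg : Wsum g) (k : ℤ) :
    wt k * ‖conv f g k‖ ≤ ∑' j, (wt j * ‖f j‖) * (wt (k - j) * ‖g (k - j)‖) := by
  have hs := summable_mul_shift (wt_mul_norm_nonneg f) (wt_mul_norm_nonneg g) hf hg k
  have h1 : Summable fun j => wt k * ‖f j * g (k - j)‖ := (hf.summable_mul hg k).norm.mul_left _
  calc wt k * ‖conv f g k‖ ≤ wt k * ∑' j, ‖f j * g (k - j)‖ :=
        mul_le_mul_of_nonneg_left (norm_tsum_le_tsum_norm (hf.summable_mul hg k).norm) (wt_pos k).le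
    _ = ∑' j, wt k * ‖f j * g (k - j)‖ := tsum_mul_left.symm
    _ ≤ _ := by
      refine h1.tsum_le_tsum (fun j => ?_) hs
      have := mul_le_mul_of_nonneg_right (wt_mul_le j k) (norm_nonneg (f j * g (k - j)))
      rw [norm_mul] at this ⊢
      linarith

/-- The product estimate behind all nonlinear terms except the transport one: one derivative of a
product, with `f` measured in H¹ and `g` in the weighted ℓ¹ norm, paired with a square-summable
sequence. -/
lemma sum_wt_conv_le (s : Finset ℤ) {a : ℤ → ℝ} (ha : ∀ k, 0 ≤ a k) {f g : ℤ → ℂ} (hf : Wsum f)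
    (hg : Wsum g) : ∑ k ∈ s, a k * (wt k * ‖conv f g k‖) ≤
      wnorm g / 2 * (∑ k ∈ s, a k ^ 2 + ∑' k, (wt k * ‖f k‖) ^ 2) :=
  (Finset.sum_le_sum fun k _ => mul_le_mul_of_nonneg_left (wt_mul_conv_le hf hg k) (ha k)).trans
    (schur s (wt_mul_norm_nonneg f) (wt_mul_norm_nonneg g) hf hg)

/-- Truncation to the frequencies of `S_N`. -/
def trunc (N : ℕ) (f : ℤ → ℂ) (k : ℤ) : ℂ := if k ∈ freq N then f k else 0

/-- The part of a sequence outside the frequencies of `S_N`. -/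
def tail (N : ℕ) (f : ℤ → ℂ) (k : ℤ) : ℂ := if k ∈ freq N then 0 else f k

lemma norm_trunc_le (N : ℕ) (f : ℤ → ℂ) (k : ℤ) : ‖trunc N f k‖ ≤ ‖f k‖ := by
  rw [trunc]; split_ifs <;> simp

lemma norm_tail_le (N : ℕ) (f : ℤ → ℂ) (k : ℤ) : ‖tail N f k‖ ≤ ‖f k‖ := by
  rw [tail]; split_ifs <;> simp

lemma trunc_add_tail (N : ℕ) (f : ℤ → ℂ) (k : ℤ) : trunc N f k + tail N f k = f k := by
  rw [trunc, tail]; split_ifs <;> simp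

/-- The error of a product, decomposed into perturbation and truncation terms. -/
lemma conv_error (N : ℕ) {z w A B : ℤ → ℂ} (hz : Wsum z) (hw : Wsum w) (hA : Wsum A) (hB : Wsum B)
    (k : ℤ) : conv (trunc N z + A) (trunc N w + B) k - conv z w k =
      conv A (trunc N w + B) k + conv B (trunc N z) k - conv (tail N w) (trunc N z) k
        - conv (tail N z) w k := by
  have hzN := hz.of_le (norm_trunc_le N z)
  have hwN := hw.of_le (norm_trunc_le N w)
  have hzt := hz.of_le (norm_tail_le N z)
  have hwt := hw.of_le (norm_tail_le N w)
  -- The statement puts the small factors `B` and `tail N w` first because `sum_wt_conv_le` measures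
  -- the first factor in ℓ² and the second in ℓ¹. Bilinear expansion needs the original order.
  rw [conv_comm B, conv_comm (tail N w)]
  simp only [conv]
  rw [← ((hzN.add hA).summable_mul (hwN.add hB) k).tsum_sub (hz.summable_mul hw k),
    ← (hA.summable_mul (hwN.add hB) k).tsum_add (hzN.summable_mul hB k),
    ← ((hA.summable_mul (hwN.add hB) k).add (hzN.summable_mul hB k)).tsum_sub
      (hzN.summable_mul hwt k),
    ← (((hA.summable_mul (hwN.add hB) k).add (hzN.summable_mul hB k)).sub
      (hzN.summable_mul hwt k)).tsum_sub (hzt.summable_mul hw k)]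
  congr 1; ext j
  have h1 := trunc_add_tail N z j
  have h2 := trunc_add_tail N w (k - j)
  simp only [Pi.add_apply]
  linear_combination w (k - j) * h1 + trunc N z j * h2

/-- The derivative in the transport term can be moved to the coefficient. -/
lemma transport_le {N : ℕ} {A g : ℤ → ℂ} (hA : ∀ k ∉ freq N, A k = 0) (hg : Wsum g)
    (hgc : ∀ k, g (-k) = (starRingEnd ℂ) (g k)) :
    |(∑ k ∈ freq N, sym k * (starRingEnd ℂ) (A k) * conv A g k).re| ≤
      Real.pi * wnorm g * ∑ k ∈ freq N, ‖A k‖ ^ 2 := by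
  set X := ∑ k ∈ freq N, sym k * (starRingEnd ℂ) (A k) * conv A g k with hX
  have e1 : X = ∑ k ∈ freq N, ∑ j ∈ freq N, sym k * (starRingEnd ℂ) (A k) * (A j * g (k - j)) := by
    rw [hX]
    refine Finset.sum_congr rfl fun k _ => ?_
    rw [conv_eq_dconv hA, dconv, Finset.mul_sum]
  -- Conjugation followed by exchanging the two indices reproduces the same double sum with `sym k`
  -- replaced by `-sym j`; the reality of `g` is used here.
  have e2 : (starRingEnd ℂ) X =
      ∑ k ∈ freq N, ∑ j ∈ freq N, -sym j * (starRingEnd ℂ) (A k) * (A j * g (k - j)) := by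
    rw [e1, Finset.sum_comm]
    simp only [map_sum]
    refine Finset.sum_congr rfl fun k _ => Finset.sum_congr rfl fun j _ => ?_
    have : (starRingEnd ℂ) (g (j - k)) = g (k - j) := by rw [← hgc, neg_sub]
    simp only [map_mul, conj_sym, Complex.conj_conj, this]
    ring
  -- In X + conj X the symbols combine to sym k - sym j = sym (k - j), so the derivative falls on
  -- `g` alone.
  have e3 : ((2 * X.re : ℝ) : ℂ) =
      ∑ k ∈ freq N, ∑ j ∈ freq N, (starRingEnd ℂ) (A k) * (A j * (sym (k - j) * g (k - j))) := by
    have h2 : ((2 * X.re : ℝ) : ℂ) = X + (starRingEnd ℂ) X := by rw [Complex.add_conj]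
    rw [h2, e2, e1, ← Finset.sum_add_distrib]
    refine Finset.sum_congr rfl fun k _ => ?_
    rw [← Finset.sum_add_distrib]
    refine Finset.sum_congr rfl fun j _ => ?_
    rw [sym_sub]; ring
  have hAs : Summable fun j => ‖A j‖ :=
    summable_of_ne_finset_zero (s := freq N) fun j hj => by rw [hA j hj, norm_zero]
  have e4 : |2 * X.re| ≤ 2 * Real.pi *
      ∑ k ∈ freq N, ‖A k‖ * ∑' j, ‖A j‖ * (wt (k - j) * ‖g (k - j)‖) := by
    rw [← Real.norm_eq_abs, ← Complex.norm_real, e3, Finset.mul_sum]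
    refine norm_sum_le_of_le _ fun k _ => ?_
    have h3 : ∑' j, ‖A j‖ * (wt (k - j) * ‖g (k - j)‖)
        = ∑ j ∈ freq N, ‖A j‖ * (wt (k - j) * ‖g (k - j)‖) :=
      tsum_eq_sum fun j hj => by rw [hA j hj, norm_zero, zero_mul]
    rw [h3, Finset.mul_sum, Finset.mul_sum]
    refine norm_sum_le_of_le _ fun j _ => ?_
    rw [norm_mul, norm_mul, norm_mul, RCLike.norm_conj]
    have := norm_sym_le (k - j)
    calc ‖A k‖ * (‖A j‖ * (‖sym (k - j)‖ * ‖g (k - j)‖))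
        ≤ ‖A k‖ * (‖A j‖ * (2 * Real.pi * wt (k - j) * ‖g (k - j)‖)) := by gcongr
      _ = _ := by ring
  have e5 := schur (freq N) (a := fun k => ‖A k‖) (b := fun k => ‖A k‖)
    (q := fun k => wt k * ‖g k‖) (fun _ => norm_nonneg _) (wt_mul_norm_nonneg g) hAs hg
  have e6 : ∑' k, ‖A k‖ ^ 2 = ∑ k ∈ freq N, ‖A k‖ ^ 2 :=
    tsum_eq_sum fun j hj => by rw [hA j hj, norm_zero]; simp
  rw [e6] at e5
  rw [abs_mul, abs_two] at e4
  change _ ≤ wnorm g / 2 * _ at e5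
  have := mul_le_mul_of_nonneg_left e5 (by positivity : 0 ≤ 2 * Real.pi)
  linarith

/-! ### The energy estimate -/

/-- The weight `κ₁ - a ω²`, `ω = 2πk`. -/
def hwt (p : BBParams) (k : ℤ) : ℝ := p.κ₁ - p.a * (2 * Real.pi * k) ^ 2

/-- The weight of `u` in the energy. -/
def gwt (p : BBParams) (k : ℤ) : ℝ := hwt p k * (1 + p.d * (2 * Real.pi * k) ^ 2)

/-- The energy of an error with Fourier coefficients `A`, `B`. -/
def energy (p : BBParams) (N : ℕ) (A B : ℤ → ℂ) : ℝ :=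
  ∑ k ∈ freq N, (p.κ₂ * ‖A k‖ ^ 2 + gwt p k * ‖B k‖ ^ 2)

lemma κ₁_pos {p : BBParams} (hp : p.Physical) : 0 < p.κ₁ := by
  obtain ⟨h1, h2, h3⟩ := hp
  rw [BBParams.κ₁]; positivity

lemma κ₂_pos {p : BBParams} (hp : p.Physical) : 0 < p.κ₂ := by
  obtain ⟨h1, h2, h3⟩ := hp
  rw [BBParams.κ₂]; linarith

lemma sq_le_omega_sq (k : ℤ) : (k : ℝ) ^ 2 ≤ (2 * Real.pi * k) ^ 2 := by
  rw [mul_pow]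
  have := Real.pi_gt_three
  exact le_mul_of_one_le_left (sq_nonneg _) (by nlinarith)

lemma omega_sq_le (k : ℤ) : (2 * Real.pi * k) ^ 2 ≤ 40 * (k : ℝ) ^ 2 := by
  rw [mul_pow]
  refine mul_le_mul_of_nonneg_right ?_ (sq_nonneg _)
  have := Real.pi_gt_three
  -- π < 3.15 gives 4π² < 39.7, which explains the constant 40.
  have := Real.pi_lt_d2
  nlinarith

lemma le_hwt {p : BBParams} (hp : p.Physical) (hvi : p.CaseVI) (k : ℤ) :
    min p.κ₁ (-p.a) / 2 * wt k ^ 2 ≤ hwt p k := by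
  have h1 := κ₁_pos hp
  obtain ⟨-, hd, ha, -⟩ := hvi
  have h2 : 0 < min p.κ₁ (-p.a) := lt_min h1 (by linarith)
  have h3 := min_le_left p.κ₁ (-p.a)
  have h4 := min_le_right p.κ₁ (-p.a)
  set α := min p.κ₁ (-p.a)
  have h5 := sq_le_omega_sq k
  have h6 := wt_sq_le k
  rw [hwt]
  have h7 := mul_le_mul_of_nonneg_left h6 h2.le
  have h8 : α * (k : ℝ) ^ 2 ≤ -p.a * (2 * Real.pi * k) ^ 2 :=
    mul_le_mul h4 h5 (sq_nonneg _) (by linarith)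
  linarith

lemma hwt_le {p : BBParams} (hp : p.Physical) (hvi : p.CaseVI) (k : ℤ) :
    hwt p k ≤ (p.κ₁ - 40 * p.a) * wt k ^ 2 := by
  have h1 := κ₁_pos hp
  obtain ⟨-, hd, ha, -⟩ := hvi
  have h5 := omega_sq_le k
  have h6 := le_wt_sq k
  rw [hwt]
  nlinarith [sq_nonneg (k : ℝ)]

lemma hwt_pos {p : BBParams} (hp : p.Physical) (hvi : p.CaseVI) (k : ℤ) : 0 < hwt p k := by
  have h1 := κ₁_pos hp
  obtain ⟨-, hd, ha, -⟩ := hvi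
  rw [hwt]
  nlinarith [sq_nonneg (2 * Real.pi * k)]

/-- The coercivity constant of the energy. -/
def coer (p : BBParams) : ℝ := min p.κ₁ (-p.a) / 2 * (min 1 p.d / 2)

lemma coer_pos {p : BBParams} (hp : p.Physical) (hvi : p.CaseVI) : 0 < coer p := by
  have h1 := κ₁_pos hp
  obtain ⟨-, hd, ha, -⟩ := hvi
  have h2 : 0 < min p.κ₁ (-p.a) := lt_min h1 (by linarith)
  have h3 : 0 < min 1 p.d := lt_min one_pos hd
  rw [coer]; positivity

/-- Both factors of `gwt` are elliptic of order two, because a < 0 and d > 0. The product is of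
order four, so the energy controls `B` in H², one derivative beyond what the theorem asks; the
nonlinear terms use it up. -/
lemma le_gwt {p : BBParams} (hp : p.Physical) (hvi : p.CaseVI) (k : ℤ) :
    coer p * (wt k ^ 2) ^ 2 ≤ gwt p k := by
  have h0 := le_hwt hp hvi k
  have hh := hwt_pos hp hvi k
  obtain ⟨-, hd, ha, -⟩ := hvi
  have h3 : 0 < min 1 p.d := lt_min one_pos hd
  have h4 := min_le_left 1 p.d
  have h5 := min_le_right 1 p.d
  have h6 : min 1 p.d / 2 * wt k ^ 2 ≤ 1 + p.d * (2 * Real.pi * k) ^ 2 := by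
    have h7 := mul_le_mul_of_nonneg_left (wt_sq_le k) h3.le
    have h8 : min 1 p.d * (k : ℝ) ^ 2 ≤ p.d * (2 * Real.pi * k) ^ 2 :=
      mul_le_mul h5 (sq_le_omega_sq k) (sq_nonneg _) hd.le
    linarith
  rw [gwt, coer]
  have := mul_le_mul h0 h6 (by positivity) hh.le
  linarith

lemma gwt_nonneg {p : BBParams} (hp : p.Physical) (hvi : p.CaseVI) (k : ℤ) : 0 ≤ gwt p k :=
  (by have := coer_pos hp hvi; positivity : 0 ≤ coer p * (wt k ^ 2) ^ 2).trans (le_gwt hp hvi k)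

lemma energy_nonneg {p : BBParams} (hp : p.Physical) (hvi : p.CaseVI) (N : ℕ) (A B : ℤ → ℂ) :
    0 ≤ energy p N A B :=
  Finset.sum_nonneg fun k _ => add_nonneg (mul_nonneg (κ₂_pos hp).le (sq_nonneg _))
    (mul_nonneg (gwt_nonneg hp hvi k) (sq_nonneg _))

lemma sum_sq_le_energy {p : BBParams} (hp : p.Physical) (hvi : p.CaseVI) (N : ℕ) (A B : ℤ → ℂ) :
    ∑ k ∈ freq N, ‖A k‖ ^ 2 ≤ (p.κ₂)⁻¹ * energy p N A B := by
  have h := κ₂_pos hp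
  rw [energy, Finset.mul_sum]
  refine Finset.sum_le_sum fun k _ => ?_
  rw [inv_mul_eq_div, le_div_iff₀ h]
  have := mul_nonneg (gwt_nonneg hp hvi k) (sq_nonneg ‖B k‖)
  linarith

lemma sum_wt_sq_le_energy {p : BBParams} (hp : p.Physical) (hvi : p.CaseVI) (N : ℕ)
    (A B : ℤ → ℂ) : ∑ k ∈ freq N, (wt k ^ 2 * ‖B k‖) ^ 2 ≤ (coer p)⁻¹ * energy p N A B := by
  have h := coer_pos hp hvi
  rw [energy, Finset.mul_sum]
  refine Finset.sum_le_sum fun k _ => ?_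
  rw [inv_mul_eq_div, le_div_iff₀ h]
  have h1 := mul_le_mul_of_nonneg_right (le_gwt hp hvi k) (sq_nonneg ‖B k‖)
  have h2 := mul_nonneg (κ₂_pos hp).le (sq_nonneg ‖A k‖)
  rw [mul_pow]; linarith

/-- The time derivative of the energy of the error `(A, B)` with respect to `(z, w)`, when
`(z, w)` solves the continuous problem and the truncation of `(z, w)` plus `(A, B)` the
semidiscrete one. -/
def energyRate (p : BBParams) (N : ℕ) (z w A B : ℤ → ℂ) : ℝ :=
  ∑ k ∈ freq N, (p.κ₂ * (2 * ((starRingEnd ℂ) (A k) *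
        (rhsζ p k ((trunc N w + B) k) (dconv N (trunc N z + A) (trunc N w + B) k)
          - rhsζ p k (w k) (conv z w k))).re)
      + gwt p k * (2 * ((starRingEnd ℂ) (B k) *
        (rhsu p k ((trunc N z + A) k) (dconv N (trunc N w + B) (trunc N w + B) k)
          - rhsu p k (z k) (conv w w k))).re))

/-- The energy weights are chosen for this identity: the linear contributions of the two equations
form a purely imaginary sum, and only quadratic differences survive. -/
lemma energyRate_eq {p : BBParams} (hvi : p.CaseVI) {N : ℕ} {z w A B : ℤ → ℂ}
    (hA : ∀ k ∉ freq N, A k = 0) (hB : ∀ k ∉ freq N, B k = 0) :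
    energyRate p N z w A B =
      -(2 * p.κ₂ * p.lam) * (∑ k ∈ freq N, sym k * (starRingEnd ℂ) (A k) *
          (conv (trunc N z + A) (trunc N w + B) k - conv z w k)).re
      - p.lam * (∑ k ∈ freq N, hwt p k * sym k * (starRingEnd ℂ) (B k) *
          (conv (trunc N w + B) (trunc N w + B) k - conv w w k)).re := by
  obtain ⟨-, hd, -, -⟩ := hvi
  have s1 : ∀ k ∉ freq N, (trunc N z + A) k = 0 := fun k hk => by
    rw [Pi.add_apply, trunc, if_neg hk, hA k hk, add_zero]
  have s2 : ∀ k ∉ freq N, (trunc N w + B) k = 0 := fun k hk => by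
    rw [Pi.add_apply, trunc, if_neg hk, hB k hk, add_zero]
  rw [energyRate, Complex.re_sum, Complex.re_sum, Finset.mul_sum, Finset.mul_sum,
    ← Finset.sum_sub_distrib]
  refine Finset.sum_congr rfl fun k hk => ?_
  rw [← conv_eq_dconv s1, ← conv_eq_dconv s2]
  set P := conv (trunc N z + A) (trunc N w + B) k
  set Q := conv (trunc N w + B) (trunc N w + B) k
  set P' := conv z w k
  set Q' := conv w w k
  have e1 : (trunc N w + B) k = w k + B k := by rw [Pi.add_apply, trunc, if_pos hk]
  have e2 : (trunc N z + A) k = z k + A k := by rw [Pi.add_apply, trunc, if_pos hk]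
  rw [e1, e2]
  have eh : (hwt p k : ℂ) = p.κ₁ + p.a * sym k ^ 2 := by
    rw [hwt, sym_sq]; push_cast; ring
  have eg : (gwt p k : ℂ) = hwt p k * (1 - p.d * sym k ^ 2) := by
    rw [gwt, sym_sq]; push_cast; ring
  -- Multiplication by `gwt` cancels the denominator of `rhsu`. The ζ equation contributes `hwt p k
  -- * sym k` because κ₁ sym + a sym³ = sym (κ₁ + a sym²). Both cross terms then have the same
  -- coefficient.
  have key : (p.κ₂ : ℂ) * ((starRingEnd ℂ) (A k) * (rhsζ p k (w k + B k) P - rhsζ p k (w k) P'))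
      + gwt p k * ((starRingEnd ℂ) (B k) * (rhsu p k (z k + A k) Q - rhsu p k (z k) Q'))
      = -(p.κ₂ * hwt p k * (sym k * ((starRingEnd ℂ) (A k) * B k + (starRingEnd ℂ) (B k) * A k)))
        - (p.κ₂ * p.lam * (sym k * (starRingEnd ℂ) (A k) * (P - P')))
        - (p.lam / 2 * (hwt p k * sym k * (starRingEnd ℂ) (B k) * (Q - Q'))) := by
    have hne := one_sub_mul_sym_sq_ne hd k
    rw [eg, rhsu, rhsu, ← sub_div, mul_assoc, mul_left_comm (1 - (p.d : ℂ) * sym k ^ 2),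
      mul_div_cancel₀ _ hne, eh, rhsζ, rhsζ]
    ring
  have key2 := congrArg Complex.re key
  -- The symbol is imaginary and the bracket is a number plus its conjugate, hence real.
  have h0 : (sym k * ((starRingEnd ℂ) (A k) * B k + (starRingEnd ℂ) (B k) * A k)).re = 0 := by
    have : (starRingEnd ℂ) (sym k * ((starRingEnd ℂ) (A k) * B k + (starRingEnd ℂ) (B k) * A k))
        = -(sym k * ((starRingEnd ℂ) (A k) * B k + (starRingEnd ℂ) (B k) * A k)) := by
      simp only [map_mul, map_add, conj_sym, Complex.conj_conj]; ring
    have := congrArg Complex.re this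
    rw [Complex.conj_re, Complex.neg_re] at this
    linarith
  have e3 : (p.κ₂ : ℂ) * hwt p k = ((p.κ₂ * hwt p k : ℝ) : ℂ) := by push_cast; ring
  have e4 : (p.κ₂ : ℂ) * p.lam = ((p.κ₂ * p.lam : ℝ) : ℂ) := by push_cast; ring
  have e5 : (p.lam : ℂ) / 2 = ((p.lam / 2 : ℝ) : ℂ) := by push_cast; ring
  rw [e3, e4, e5, Complex.add_re, Complex.sub_re, Complex.sub_re, Complex.neg_re,
    Complex.re_ofReal_mul, Complex.re_ofReal_mul, Complex.re_ofReal_mul, Complex.re_ofReal_mul,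
    Complex.re_ofReal_mul, h0] at key2
  linarith

/-- The multiplier `r` may exceed the square-summable sequence `a` by one factor `wt`; that factor
is passed to the convolution. -/
lemma abs_re_sum_conv_le {N : ℕ} {a : ℤ → ℝ} {r f g : ℤ → ℂ} {R L : ℝ} (hR : 0 ≤ R)
    (ha : ∀ k, 0 ≤ a k) (hr : ∀ k, ‖r k‖ ≤ R * (a k * wt k)) (hf : Wsum f) (hg : Wsum g)
    (hL : wnorm g ≤ L) : |(∑ k ∈ freq N, r k * conv f g k).re| ≤
      R * (L / 2 * (∑ k ∈ freq N, a k ^ 2 + ∑' k, (wt k * ‖f k‖) ^ 2)) := by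
  have h1 : ‖∑ k ∈ freq N, r k * conv f g k‖ ≤ R * ∑ k ∈ freq N, a k * (wt k * ‖conv f g k‖) := by
    rw [Finset.mul_sum]
    refine norm_sum_le_of_le _ fun k _ => ?_
    rw [norm_mul]
    calc ‖r k‖ * ‖conv f g k‖ ≤ R * (a k * wt k) * ‖conv f g k‖ :=
          mul_le_mul_of_nonneg_right (hr k) (norm_nonneg _)
      _ = _ := by ring
  refine (Complex.abs_re_le_norm _).trans (h1.trans (mul_le_mul_of_nonneg_left ?_ hR))
  refine (sum_wt_conv_le _ ha hf hg).trans (mul_le_mul_of_nonneg_right (by linarith) ?_)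
  exact add_nonneg (Finset.sum_nonneg fun _ _ => sq_nonneg _) (tsum_nonneg fun _ => sq_nonneg _)

lemma tsum_wt_sq_of_support {N : ℕ} {f : ℤ → ℂ} (h : ∀ k ∉ freq N, f k = 0) :
    ∑' k, (wt k * ‖f k‖) ^ 2 = ∑ k ∈ freq N, (wt k * ‖f k‖) ^ 2 :=
  tsum_eq_sum fun k hk => by rw [h k hk]; simp

/-- The constant bounding the weighted `ℓ¹` norm by the weighted `ℓ²` norm. -/
def embedConst : ℝ := ∑' k : ℤ, (1 + (k : ℝ) ^ 2) ^ (-(2 - 1 : ℝ))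

/-- The embedding with exponent 2. The sum on the right is controlled by the energy, so the error is
bounded in weighted ℓ¹ independently of `N` as long as the energy is. -/
lemma wnorm_le_of_support {N : ℕ} {f : ℤ → ℂ} (h : ∀ k ∉ freq N, f k = 0) :
    wnorm f ≤ embedConst + ∑ k ∈ freq N, (wt k ^ 2 * ‖f k‖) ^ 2 := by
  have hs : Summable fun k : ℤ => (1 + (k : ℝ) ^ 2) ^ (2 : ℝ) * ‖f k‖ ^ 2 :=
    summable_of_ne_finset_zero (s := freq N) fun k hk => by rw [h k hk]; simp
  refine (tsum_wt_mul_le (s := 2) (by norm_num) (fun k => norm_nonneg (f k)) hs).trans ?_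
  refine add_le_add le_rfl ?_
  rw [tsum_eq_sum (s := freq N) fun k hk => by rw [h k hk]; simp]
  refine Finset.sum_le_sum fun k _ => ?_
  rw [mul_pow]
  refine mul_le_mul_of_nonneg_right ?_ (sq_nonneg _)
  rw [Real.rpow_two]
  exact pow_le_pow_left₀ (by positivity) (le_wt_sq k) 2

-- The differential inequality for the error energy, with `K` depending on the exact solution only
-- through `M`. The restriction to energy at most 1 bounds the coefficient u_N = P_N u + B of the
-- quadratic terms, so that the inequality becomes linear.
set_option maxHeartbeats 1000000 in
lemma exists_energyRate_le {p : BBParams} (hp : p.Physical) (hvi : p.CaseVI) (M : ℝ) :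
    ∃ K, 0 ≤ K ∧ ∀ (N : ℕ) (z w A B : ℤ → ℂ) (τ : ℝ), Wsum z → Wsum w → wnorm z ≤ M → wnorm w ≤ M →
      (∀ k, w (-k) = (starRingEnd ℂ) (w k)) → (∀ k, B (-k) = (starRingEnd ℂ) (B k)) →
      (∀ k ∉ freq N, A k = 0) → (∀ k ∉ freq N, B k = 0) →
      ∑' k, (wt k * ‖tail N z k‖) ^ 2 ≤ τ → ∑' k, (wt k * ‖tail N w k‖) ^ 2 ≤ τ →
      energy p N A B ≤ 1 → energyRate p N z w A B ≤ K * (energy p N A B + τ) := by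
  have hκ := κ₂_pos hp
  have hc := coer_pos hp hvi
  have hC0 : 0 ≤ embedConst := tsum_nonneg fun k => (weight_pos _ k).le
  -- A common ℓ¹ bound: `M` covers ζ, u and their truncations, the other two summands cover `B` when
  -- the energy is at most 1.
  set L := |M| + embedConst + (coer p)⁻¹ with hL
  set H := p.κ₁ - 40 * p.a with hH
  have hH0 : 0 < H := by have := κ₁_pos hp; have := hvi.2.2.1; rw [hH]; linarith
  set c₁ := (p.κ₂)⁻¹ + (coer p)⁻¹ with hc₁
  have hL0 : 0 ≤ L := by positivity
  have hc₁0 : 0 ≤ c₁ := by positivity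
  have hπ := Real.pi_pos
  -- 8κ₂ is 2κ₂ times the factor 4 of `n1`, 6H comes from `n2`, and `c₁` converts the ℓ² sums of `A`
  -- and `B` into energy.
  refine ⟨|p.lam| * Real.pi * L * (8 * p.κ₂ + 6 * H) * (c₁ + 1), by positivity, ?_⟩
  intro N z w A B τ hz hw hzM hwM hwc hBc hA hB hτz hτw hE
  have hE0 := energy_nonneg hp hvi N A B
  have ha0 := sum_sq_le_energy hp hvi N A B
  have hb2 := sum_wt_sq_le_energy hp hvi N A B
  set e := energy p N A B with he
  set a0 := ∑ k ∈ freq N, ‖A k‖ ^ 2 with ha0'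
  set b2 := ∑ k ∈ freq N, (wt k ^ 2 * ‖B k‖) ^ 2 with hb2'
  have hMM := le_abs_self M
  have hc0' : 0 < (coer p)⁻¹ := inv_pos.2 hc
  have hzL : wnorm z ≤ L := by rw [hL]; linarith
  have hwL : wnorm w ≤ L := by rw [hL]; linarith
  have hzN := hz.of_le (norm_trunc_le N z)
  have hwN := hw.of_le (norm_trunc_le N w)
  have hzt := hz.of_le (norm_tail_le N z)
  have hwtl := hw.of_le (norm_tail_le N w)
  have hAs := Wsum.of_support hA
  have hBs := Wsum.of_support hB
  have hzNL : wnorm (trunc N z) ≤ L := (wnorm_mono hz (norm_trunc_le N z)).trans hzL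
  have hwNL : wnorm (trunc N w) ≤ L := (wnorm_mono hw (norm_trunc_le N w)).trans hwL
  have hgs := hwN.add hBs
  have hgL : wnorm (trunc N w + B) ≤ L := by
    have h1 := wnorm_add_le hwN hBs
    have h2 := wnorm_mono hw (norm_trunc_le N w)
    have h3 := wnorm_le_of_support hB
    have h4 : (coer p)⁻¹ * e ≤ (coer p)⁻¹ := mul_le_of_le_one_right hc0'.le hE
    rw [hL]; linarith
  have hgc : ∀ k, (trunc N w + B) (-k) = (starRingEnd ℂ) ((trunc N w + B) k) := by
    intro k
    simp only [Pi.add_apply, trunc, neg_mem_freq, hwc, hBc, map_add, apply_ite (starRingEnd ℂ),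
      map_zero]
  have hb1 : ∑' k, (wt k * ‖B k‖) ^ 2 ≤ b2 := by
    rw [tsum_wt_sq_of_support hB]
    refine Finset.sum_le_sum fun k _ => pow_le_pow_left₀ (wt_mul_norm_nonneg B k) ?_ 2
    refine mul_le_mul_of_nonneg_right ?_ (norm_nonneg _)
    have := one_le_wt k
    nlinarith
  have hτ0 : 0 ≤ τ := (tsum_nonneg fun _ => sq_nonneg _).trans hτz
  have ha00 : 0 ≤ a0 := Finset.sum_nonneg fun _ _ => sq_nonneg _
  have hb20 : 0 ≤ b2 := Finset.sum_nonneg fun _ _ => sq_nonneg _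
  -- the first equation
  have hr1 : ∀ k, ‖sym k * (starRingEnd ℂ) (A k)‖ ≤ 2 * Real.pi * (‖A k‖ * wt k) := fun k => by
    rw [norm_mul, RCLike.norm_conj]
    have := mul_le_mul_of_nonneg_right (norm_sym_le k) (norm_nonneg (A k))
    linarith
  -- `A` convolved with u_N would lose a derivative in `abs_re_sum_conv_le`, because the energy
  -- holds `A` only in ℓ²; the symmetrized estimate avoids the loss.
  have t1 := transport_le hA hgs hgc
  have t2 := abs_re_sum_conv_le (N := N) (by positivity) (fun k => norm_nonneg (A k)) hr1 hBs hzN hzNL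
  have t3 := abs_re_sum_conv_le (N := N) (by positivity) (fun k => norm_nonneg (A k)) hr1 hwtl hzN hzNL
  have t4 := abs_re_sum_conv_le (N := N) (by positivity) (fun k => norm_nonneg (A k)) hr1 hzt hw hwL
  have hπL : 0 ≤ Real.pi * L := by positivity
  have n1 : |(∑ k ∈ freq N, sym k * (starRingEnd ℂ) (A k) *
      (conv (trunc N z + A) (trunc N w + B) k - conv z w k)).re| ≤
      4 * (Real.pi * L) * (a0 + b2 + τ) := by
    have e1 : ∑ k ∈ freq N, sym k * (starRingEnd ℂ) (A k) *
        (conv (trunc N z + A) (trunc N w + B) k - conv z w k) =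
        ∑ k ∈ freq N, sym k * (starRingEnd ℂ) (A k) * conv A (trunc N w + B) k
        + ∑ k ∈ freq N, sym k * (starRingEnd ℂ) (A k) * conv B (trunc N z) k
        - ∑ k ∈ freq N, sym k * (starRingEnd ℂ) (A k) * conv (tail N w) (trunc N z) k
        - ∑ k ∈ freq N, sym k * (starRingEnd ℂ) (A k) * conv (tail N z) w k := by
      rw [← Finset.sum_add_distrib, ← Finset.sum_sub_distrib, ← Finset.sum_sub_distrib]
      refine Finset.sum_congr rfl fun k _ => ?_
      rw [conv_error N hz hw hAs hBs]; ring
    rw [e1, Complex.sub_re, Complex.sub_re, Complex.add_re]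
    have u1 : Real.pi * wnorm (trunc N w + B) * a0 ≤ Real.pi * L * a0 := by gcongr
    have u2 := mul_le_mul_of_nonneg_left (add_le_add_right hb1 a0) hπL
    have u3 := mul_le_mul_of_nonneg_left (add_le_add_right hτw a0) hπL
    have u4 := mul_le_mul_of_nonneg_left (add_le_add_right hτz a0) hπL
    have hπLb := mul_nonneg hπL hb20
    have hπLτ := mul_nonneg hπL hτ0
    rw [abs_le] at t1 t2 t3 t4 ⊢
    constructor <;> linarith [t1.1, t1.2, t2.1, t2.2, t3.1, t3.2, t4.1, t4.2]
  -- the second equation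
  have ha2 : ∀ k, 0 ≤ wt k ^ 2 * ‖B k‖ := fun k => by positivity
  have hr2 : ∀ k, ‖hwt p k * sym k * (starRingEnd ℂ) (B k)‖ ≤
      2 * Real.pi * H * (wt k ^ 2 * ‖B k‖ * wt k) := fun k => by
    rw [norm_mul, norm_mul, RCLike.norm_conj, Complex.norm_real,
      Real.norm_of_nonneg (hwt_pos hp hvi k).le]
    have h1 := hwt_le hp hvi k
    calc hwt p k * ‖sym k‖ * ‖B k‖ ≤ H * wt k ^ 2 * (2 * Real.pi * wt k) * ‖B k‖ := by
          gcongr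
          exact norm_sym_le k
      _ = _ := by ring
  have hR2 : 0 ≤ 2 * Real.pi * H := by positivity
  have s1 := abs_re_sum_conv_le (N := N) hR2 ha2 hr2 hBs hgs hgL
  have s2 := abs_re_sum_conv_le (N := N) hR2 ha2 hr2 hBs hwN hwNL
  have s3 := abs_re_sum_conv_le (N := N) hR2 ha2 hr2 hwtl hwN hwNL
  have s4 := abs_re_sum_conv_le (N := N) hR2 ha2 hr2 hwtl hw hwL
  have hπHL : 0 ≤ Real.pi * H * L := by positivity
  have n2 : |(∑ k ∈ freq N, hwt p k * sym k * (starRingEnd ℂ) (B k) *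
      (conv (trunc N w + B) (trunc N w + B) k - conv w w k)).re| ≤
      6 * (Real.pi * H * L) * (a0 + b2 + τ) := by
    have e1 : ∑ k ∈ freq N, hwt p k * sym k * (starRingEnd ℂ) (B k) *
        (conv (trunc N w + B) (trunc N w + B) k - conv w w k) =
        ∑ k ∈ freq N, hwt p k * sym k * (starRingEnd ℂ) (B k) * conv B (trunc N w + B) k
        + ∑ k ∈ freq N, hwt p k * sym k * (starRingEnd ℂ) (B k) * conv B (trunc N w) k
        - ∑ k ∈ freq N, hwt p k * sym k * (starRingEnd ℂ) (B k) * conv (tail N w) (trunc N w) k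
        - ∑ k ∈ freq N, hwt p k * sym k * (starRingEnd ℂ) (B k) * conv (tail N w) w k := by
      rw [← Finset.sum_add_distrib, ← Finset.sum_sub_distrib, ← Finset.sum_sub_distrib]
      refine Finset.sum_congr rfl fun k _ => ?_
      rw [conv_error N hw hw hBs hBs]; ring
    rw [e1, Complex.sub_re, Complex.sub_re, Complex.add_re]
    have u1 := mul_le_mul_of_nonneg_left (add_le_add_right hb1 b2) hπHL
    have u3 := mul_le_mul_of_nonneg_left (add_le_add_right hτw b2) hπHL
    have hπLa := mul_nonneg hπHL ha00
    have hπLτ := mul_nonneg hπHL hτ0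
    rw [abs_le] at s1 s2 s3 s4 ⊢
    constructor <;> linarith [s1.1, s1.2, s2.1, s2.2, s3.1, s3.2, s4.1, s4.2]
  rw [energyRate_eq hvi hA hB]
  set X := (∑ k ∈ freq N, sym k * (starRingEnd ℂ) (A k) *
      (conv (trunc N z + A) (trunc N w + B) k - conv z w k)).re
  set Y := (∑ k ∈ freq N, hwt p k * sym k * (starRingEnd ℂ) (B k) *
      (conv (trunc N w + B) (trunc N w + B) k - conv w w k)).re
  have v1 : -(2 * p.κ₂ * p.lam) * X ≤ 2 * p.κ₂ * |p.lam| * (4 * (Real.pi * L) * (a0 + b2 + τ)) := by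
    refine (le_abs_self _).trans ?_
    rw [abs_mul, abs_neg, abs_mul, abs_of_pos (by positivity : 0 < 2 * p.κ₂)]
    gcongr
  have v2 : -p.lam * Y ≤ |p.lam| * (6 * (Real.pi * H * L) * (a0 + b2 + τ)) := by
    refine (le_abs_self _).trans ?_
    rw [abs_mul, abs_neg]
    gcongr
  have v3 : a0 + b2 + τ ≤ (c₁ + 1) * (e + τ) := by
    have := mul_nonneg hc₁0 hτ0
    rw [hc₁] at this ⊢
    nlinarith
  have v4 : |p.lam| * Real.pi * L * (8 * p.κ₂ + 6 * H) * (a0 + b2 + τ) ≤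
      |p.lam| * Real.pi * L * (8 * p.κ₂ + 6 * H) * ((c₁ + 1) * (e + τ)) := by gcongr
  linarith

/-! ### Fourier bounds for the exact solution -/

lemma summable_tail_sq {N : ℕ} {f : ℤ → ℂ} (hf : Wsum f) :
    Summable fun k => (wt k * ‖tail N f k‖) ^ 2 :=
  summable_sq (wt_mul_norm_nonneg _) (hf.of_le (norm_tail_le N f))

lemma MemSobolev.wsum {s : ℝ} (hs : 3 / 2 < s) {g : ℝ → ℝ} (hg : MemSobolev s g) :
    Wsum (fhat g) :=
  summable_wt_mul hs (fun _ => norm_nonneg _) hg.summable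

lemma MemSobolev.wnorm_le {s : ℝ} (hs : 3 / 2 < s) {g : ℝ → ℝ} (hg : MemSobolev s g) :
    wnorm (fhat g) ≤ (∑' k : ℤ, (1 + (k : ℝ) ^ 2) ^ (-(s - 1))) + sobSq s g :=
  tsum_wt_mul_le hs (fun _ => norm_nonneg _) hg.summable

/-- The tail is needed in H¹, since the product it enters is differentiated once; against H^s this
gains N^{1-s}. -/
lemma MemSobolev.tail_le {s : ℝ} (hs : 3 / 2 < s) {g : ℝ → ℝ} (hg : MemSobolev s g) {N : ℕ}
    (hN : 1 ≤ N) :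
    ∑' k, (wt k * ‖tail N (fhat g) k‖) ^ 2 ≤ 2 * sobSq s g * ((N : ℝ) ^ (1 - s)) ^ 2 := by
  have h1 : ∀ k, (wt k * ‖tail N (fhat g) k‖) ^ 2 ≤
      2 * ((N : ℝ) ^ (1 - s)) ^ 2 * ((1 + (k : ℝ) ^ 2) ^ s * ‖fhat g k‖ ^ 2) := by
    intro k
    by_cases hk : k ∈ freq N
    · rw [tail, if_pos hk, norm_zero, mul_zero, zero_pow two_ne_zero]
      have := weight_pos s k
      positivity
    · rw [tail, if_neg hk, mul_pow]
      have h2 := wt_sq_le k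
      have h3 := tail_weight_le (s := s) (by linarith) hN hk
      have := mul_le_mul_of_nonneg_right (h2.trans (mul_le_mul_of_nonneg_left h3 zero_le_two))
        (sq_nonneg ‖fhat g k‖)
      linarith
  refine ((summable_tail_sq (hg.wsum hs)).tsum_le_tsum h1 (hg.summable.mul_left _)).trans_eq ?_
  rw [tsum_mul_left, sobSq]; ring

/-- Uniform bounds for the Fourier coefficients of the exact solution. -/
lemma IsC1Sobolev.fourier_bounds {s T : ℝ} (hs : 3 / 2 < s) {f f' : ℝ → ℝ → ℝ}
    (h : IsC1Sobolev s T f f') : ∃ M, 0 < M ∧ ∀ t ∈ Icc 0 T, Wsum (fhat (f t)) ∧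
      wnorm (fhat (f t)) ≤ M ∧ ∀ N : ℕ, 1 ≤ N →
        ∑' k, (wt k * ‖tail N (fhat (f t)) k‖) ^ 2 ≤ M * ((N : ℝ) ^ (1 - s)) ^ 2 := by
  obtain ⟨M, hM⟩ := h.sobSq_bounded
  have hc : 0 ≤ ∑' k : ℤ, (1 + (k : ℝ) ^ 2) ^ (-(s - 1)) := tsum_nonneg fun k => (weight_pos _ k).le
  refine ⟨(∑' k : ℤ, (1 + (k : ℝ) ^ 2) ^ (-(s - 1))) + 2 * |M| + 1, by positivity,
    fun t ht => ⟨(h.mem t ht).wsum hs, ?_, fun N hN => ?_⟩⟩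
  · have := (h.mem t ht).wnorm_le hs
    have := hM t ht
    linarith [le_abs_self M, abs_nonneg M]
  · refine ((h.mem t ht).tail_le hs hN).trans (mul_le_mul_of_nonneg_right ?_ (sq_nonneg _))
    have := hM t ht
    linarith [le_abs_self M]

/-! ### The barrier argument and the error bound in the energy -/

/-- A differential inequality that is only known to hold below the level `1`. -/
lemma le_of_deriv_le {E E' : ℝ → ℝ} {T K τ : ℝ} (hK : 0 ≤ K) (hτ : 0 < τ)
    (hd : ∀ t ∈ Icc 0 T, HasDerivWithinAt E (E' t) (Icc 0 T) t) (h0 : E 0 = 0)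
    (hb : ∀ t ∈ Icc 0 T, E t ≤ 1 → E' t ≤ K * (E t + τ))
    (hs : τ * Real.exp ((2 * K + 1) * T) ≤ 1) :
    ∀ t ∈ Icc 0 T, E t ≤ τ * Real.exp ((2 * K + 1) * T) := by
  have hBmono : ∀ t ∈ Icc 0 T, τ * Real.exp ((2 * K + 1) * t) ≤ τ * Real.exp ((2 * K + 1) * T) := by
    intro t ht
    have := ht.2
    gcongr
  have key := image_le_of_deriv_right_lt_deriv_boundary (f := E) (f' := E') (a := 0) (b := T)
    (B := fun t => τ * Real.exp ((2 * K + 1) * t))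
    (B' := fun t => (2 * K + 1) * (τ * Real.exp ((2 * K + 1) * t)))
    (fun t ht => (hd t ht).continuousWithinAt)
    (fun t ht => ((hd t (Ico_subset_Icc_self ht)).mono_of_mem_nhdsWithin
      (Icc_mem_nhdsGE_of_mem ht)))
    (by simp [h0, hτ.le])
    (fun t => by
      have := (((hasDerivAt_id t).const_mul (2 * K + 1)).exp).const_mul τ
      simp only [id, mul_one] at this
      exact this.congr_deriv (by ring))
    -- At a contact with the barrier E equals its value, which lies between τ and 1. Hence the
    -- inequality is available and E' ≤ K(E + τ) ≤ 2KE < (2K + 1)E. The extra 1 in the exponent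
    -- provides the strictness.
    (fun t ht heq => by
      have ht' := Ico_subset_Icc_self ht
      have h1 : E t ≤ 1 := by rw [heq]; exact (hBmono t ht').trans hs
      have h2 := hb t ht' h1
      have h3 : τ ≤ E t := by
        rw [heq]
        refine le_mul_of_one_le_right hτ.le (Real.one_le_exp ?_)
        have := ht.1
        positivity
      rw [← heq]
      nlinarith [mul_le_mul_of_nonneg_left h3 hK])
  intro t ht
  exact (key ht).trans (hBmono t ht)

lemma hasDerivWithinAt_normSq {f : ℝ → ℂ} {f' : ℂ} {s : Set ℝ} {t : ℝ}
    (h : HasDerivWithinAt f f' s t) :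
    HasDerivWithinAt (fun r => ‖f r‖ ^ 2) (2 * ((starRingEnd ℂ) (f t) * f').re) s t := by
  have := h.norm_sq
  rwa [Complex.inner, mul_comm f'] at this

/-- The derivatives `z'`, `w'` are left arbitrary, so that the formula serves both the semidiscrete
solution and the cut-off curve. -/
lemma IsSolution.energy_hasDerivWithinAt {p : BBParams} (hvi : p.CaseVI) {s T : ℝ} (hs : 3 / 2 < s)
    {ζ₀ u₀ : ℝ → ℝ} {ζ u : ℝ → ℝ → ℝ} (h : IsSolution p s T ζ₀ u₀ ζ u) (N : ℕ)
    {z w : ℝ → ℤ → ℂ} {z' w' : ℤ → ℂ} {t : ℝ} (ht : t ∈ Icc 0 T)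
    (hz : ∀ k ∈ freq N, HasDerivWithinAt (fun r => z r k) (z' k) (Icc 0 T) t)
    (hw : ∀ k ∈ freq N, HasDerivWithinAt (fun r => w r k) (w' k) (Icc 0 T) t) :
    HasDerivWithinAt (fun r => energy p N (z r - trunc N (fhat (ζ r))) (w r - trunc N (fhat (u r))))
      (∑ k ∈ freq N, (p.κ₂ * (2 * ((starRingEnd ℂ) ((z t - trunc N (fhat (ζ t))) k) *
        (z' k - rhsζ p k (fhat (u t) k) (conv (fhat (ζ t)) (fhat (u t)) k))).re)
      + gwt p k * (2 * ((starRingEnd ℂ) ((w t - trunc N (fhat (u t))) k) *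
        (w' k - rhsu p k (fhat (ζ t) k) (conv (fhat (u t)) (fhat (u t)) k))).re))) (Icc 0 T) t := by
  obtain ⟨ζt, ut, hζ, hu, -⟩ := h.2.2
  unfold energy
  apply HasDerivWithinAt.fun_sum
  intro k hk
  obtain ⟨d1, d2⟩ := h.modal hvi (by linarith) ht k
  have c1 : conv (fhat (ζ t)) (fhat (u t)) k = fhat (fun x => ζ t x * u t x) k :=
    (hasSum_fhat_mul (hζ.mem t ht).memLp (hu.mem t ht).memLp k).tsum_eq
  have c2 : conv (fhat (u t)) (fhat (u t)) k = fhat (fun x => u t x * u t x) k :=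
    (hasSum_fhat_mul (hu.mem t ht).memLp (hu.mem t ht).memLp k).tsum_eq
  have e1 : ∀ (v : ℝ → ℤ → ℂ) (g : ℝ → ℝ → ℝ) (r : ℝ),
      (v r - trunc N (fhat (g r))) k = v r k - fhat (g r) k := fun v g r => by
    rw [Pi.sub_apply, trunc, if_pos hk]
  simp only [e1, c1, c2]
  exact ((hasDerivWithinAt_normSq ((hz k hk).sub d1)).const_mul _).add
    ((hasDerivWithinAt_normSq ((hw k hk).sub d2)).const_mul _)

/-- The error estimate in the energy norm, for curves that solve the semidiscrete problem as long
as the energy of the error is at most `1`. -/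
lemma IsSolution.exists_energy_le {p : BBParams} (hp : p.Physical) (hvi : p.CaseVI) {s T : ℝ}
    (hs : 3 / 2 < s) {ζ₀ u₀ : ℝ → ℝ} {ζ u : ℝ → ℝ → ℝ}
    (h : IsSolution p s T ζ₀ u₀ ζ u) : ∃ C, 0 < C ∧ ∀ (N : ℕ) (z w z' w' : ℝ → ℤ → ℂ), 1 ≤ N →
      (∀ t ∈ Icc 0 T, ∀ k ∉ freq N, z t k = 0) → (∀ t ∈ Icc 0 T, ∀ k ∉ freq N, w t k = 0) →
      (∀ t ∈ Icc 0 T, ∀ k, w t (-k) = (starRingEnd ℂ) (w t k)) →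
      (∀ k ∈ freq N, z 0 k = fhat ζ₀ k) → (∀ k ∈ freq N, w 0 k = fhat u₀ k) →
      (∀ t ∈ Icc 0 T, ∀ k ∈ freq N,
        HasDerivWithinAt (fun r => z r k) (z' t k) (Icc 0 T) t) →
      (∀ t ∈ Icc 0 T, ∀ k ∈ freq N,
        HasDerivWithinAt (fun r => w r k) (w' t k) (Icc 0 T) t) →
      (∀ t ∈ Icc 0 T,
        energy p N (z t - trunc N (fhat (ζ t))) (w t - trunc N (fhat (u t))) ≤ 1 →
        ∀ k ∈ freq N, z' t k = rhsζ p k (w t k) (dconv N (z t) (w t) k) ∧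
          w' t k = rhsu p k (z t k) (dconv N (w t) (w t) k)) →
      C * ((N : ℝ) ^ (1 - s)) ^ 2 ≤ 1 →
      ∀ t ∈ Icc 0 T, energy p N (z t - trunc N (fhat (ζ t))) (w t - trunc N (fhat (u t))) ≤
        C * ((N : ℝ) ^ (1 - s)) ^ 2 := by
  obtain ⟨ζt, ut, hζ, hu, -⟩ := h.2.2
  obtain ⟨M₁, hM₁, b₁⟩ := hζ.fourier_bounds hs
  obtain ⟨M₂, hM₂, b₂⟩ := hu.fourier_bounds hs
  obtain ⟨K, hK, hrate⟩ := exists_energyRate_le hp hvi (max M₁ M₂)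
  have hM : 0 < max M₁ M₂ := lt_max_of_lt_left hM₁
  -- The barrier starts from τ = max M₁ M₂ · N^{2(1-s)}, the bound for both tails, and grows by this
  -- exponential. The energy starts at 0 because the discrete initial data are projections.
  refine ⟨max M₁ M₂ * Real.exp ((2 * K + 1) * T), by positivity, ?_⟩
  intro N z w z' w' hN hz hw hwc hz0 hw0 hdz hdw heq hsmall
  have hNp : (0 : ℝ) < N := by exact_mod_cast hN
  have hε : 0 < ((N : ℝ) ^ (1 - s)) ^ 2 := by positivity
  set ε2 := ((N : ℝ) ^ (1 - s)) ^ 2 with hε2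
  have hre : max M₁ M₂ * Real.exp ((2 * K + 1) * T) * ε2 =
      max M₁ M₂ * ε2 * Real.exp ((2 * K + 1) * T) := by ring
  rw [hre] at hsmall ⊢
  have htr : ∀ f : ℤ → ℂ, ∀ k ∉ freq N, trunc N f k = 0 := fun f k hk => if_neg hk
  refine le_of_deriv_le hK (by positivity)
    (fun t ht => h.energy_hasDerivWithinAt hvi hs N ht (hdz t ht) (hdw t ht)) ?_ ?_ hsmall
  · rw [energy]
    refine Finset.sum_eq_zero fun k hk => ?_
    have e1 : ζ 0 = ζ₀ := funext h.1
    have e2 : u 0 = u₀ := funext h.2.1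
    rw [Pi.sub_apply, Pi.sub_apply, trunc, trunc, if_pos hk, if_pos hk, hz0 k hk, hw0 k hk, e1, e2]
    simp
  · intro t ht hE
    obtain ⟨s1, n1, t1⟩ := b₁ t ht
    obtain ⟨s2, n2, t2⟩ := b₂ t ht
    have key := hrate N (fhat (ζ t)) (fhat (u t)) (z t - trunc N (fhat (ζ t)))
      (w t - trunc N (fhat (u t))) (max M₁ M₂ * ε2) s1 s2 (n1.trans (le_max_left _ _))
      (n2.trans (le_max_right _ _)) (fun k => fhat_neg _ k) (fun k => ?_) (fun k hk => ?_)
      (fun k hk => ?_) ((t1 N hN).trans (mul_le_mul_of_nonneg_right (le_max_left _ _) hε.le))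
      ((t2 N hN).trans (mul_le_mul_of_nonneg_right (le_max_right _ _) hε.le)) hE
    · refine le_trans (le_of_eq ?_) key
      rw [energyRate]
      simp only [add_sub_cancel]
      refine Finset.sum_congr rfl fun k hk => ?_
      obtain ⟨q1, q2⟩ := heq t ht hE k hk
      rw [q1, q2]
    · simp only [Pi.sub_apply, trunc, neg_mem_freq, hwc t ht, fhat_neg, map_sub,
        apply_ite (starRingEnd ℂ), map_zero]
    · rw [Pi.sub_apply, hz t ht k hk, htr _ k hk, sub_zero]
    · rw [Pi.sub_apply, hw t ht k hk, htr _ k hk, sub_zero]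

/-! ### The semidiscrete problem as an ordinary differential equation -/

/-- A smooth compactly supported vector field has global solutions. -/
lemma exists_solution_of_hasCompactSupport {E : Type*} [NormedAddCommGroup E] [NormedSpace ℝ E]
    [CompleteSpace E] {G : E → E} (hG : ContDiff ℝ 1 G) (hc : HasCompactSupport G) (x₀ : E)
    {T : ℝ} (hT : 0 ≤ T) :
    ∃ α : ℝ → E, α 0 = x₀ ∧ ∀ t ∈ Icc 0 T, HasDerivWithinAt α (G (α t)) (Icc 0 T) t := by
  obtain ⟨K, hK⟩ := hG.lipschitzWith_of_hasCompactSupport hc one_ne_zero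
  obtain ⟨L, hL⟩ := hc.exists_bound_of_continuous hG.continuous
  have hL0 : 0 ≤ L := (norm_nonneg _).trans (hL x₀)
  -- The field is globally Lipschitz and bounded by `L`, so a ball of radius `L * T` accommodates
  -- the whole time interval.
  have hpl : IsPicardLindelof (fun _ => G) (⟨0, ⟨le_rfl, hT⟩⟩ : Icc 0 T) x₀
      (⟨L, hL0⟩ * ⟨T, hT⟩) 0 ⟨L, hL0⟩ K := by
    refine ⟨fun t _ => hK.lipschitzOnWith, fun x _ => continuousOn_const, fun t _ x _ => hL x, ?_⟩
    simp only [sub_zero, sub_self, NNReal.coe_zero, max_eq_left hT]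
    exact le_rfl
  exact hpl.exists_eq_forall_mem_Icc_hasDerivWithinAt₀

/-- Both trajectories are continuous on a compact interval, hence stay in one closed ball, on which
a C¹ field is Lipschitz. -/
lemma solution_unique_of_contDiff {E : Type*} [NormedAddCommGroup E] [NormedSpace ℝ E]
    [FiniteDimensional ℝ E] {F : E → E} (hF : ContDiff ℝ 1 F) {T : ℝ} {f g : ℝ → E}
    (hf : ∀ t ∈ Icc 0 T, HasDerivWithinAt f (F (f t)) (Icc 0 T) t)
    (hg : ∀ t ∈ Icc 0 T, HasDerivWithinAt g (F (g t)) (Icc 0 T) t) (h0 : f 0 = g 0) :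
    EqOn f g (Icc 0 T) := by
  have cf : ContinuousOn f (Icc 0 T) := fun t ht => (hf t ht).continuousWithinAt
  have cg : ContinuousOn g (Icc 0 T) := fun t ht => (hg t ht).continuousWithinAt
  obtain ⟨R₁, h₁⟩ := isCompact_Icc.exists_bound_of_continuousOn cf
  obtain ⟨R₂, h₂⟩ := isCompact_Icc.exists_bound_of_continuousOn cg
  obtain ⟨K, hK⟩ := (hF.locallyLipschitz.locallyLipschitzOn
    (s := Metric.closedBall (0 : E) (max R₁ R₂))).exists_lipschitzOnWith_of_compact
      (isCompact_closedBall _ _)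
  refine ODE_solution_unique_of_mem_Icc_right (v := fun _ => F)
    (s := fun _ => Metric.closedBall (0 : E) (max R₁ R₂)) (K := K) (fun t _ => hK) cf
    (fun t ht => (hf t (Ico_subset_Icc_self ht)).mono_of_mem_nhdsWithin (Icc_mem_nhdsGE_of_mem ht))
    (fun t ht => ?_) cg
    (fun t ht => (hg t (Ico_subset_Icc_self ht)).mono_of_mem_nhdsWithin (Icc_mem_nhdsGE_of_mem ht))
    (fun t ht => ?_) h0
  · exact mem_closedBall_zero_iff.2 ((h₁ t (Ico_subset_Icc_self ht)).trans (le_max_left _ _))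
  · exact mem_closedBall_zero_iff.2 ((h₂ t (Ico_subset_Icc_self ht)).trans (le_max_right _ _))

/-- Coefficient vectors of elements of `S_N`. -/
abbrev CoeffVec (N : ℕ) : Type := {k : ℤ // k ∈ freq N} → ℂ

/-- Extension of a coefficient vector by zero. -/
def extend {N : ℕ} (x : CoeffVec N) (k : ℤ) : ℂ := if h : k ∈ freq N then x ⟨k, h⟩ else 0

lemma extend_of_mem {N : ℕ} (x : CoeffVec N) {k : ℤ} (hk : k ∈ freq N) :
    extend x k = x ⟨k, hk⟩ := dif_pos hk

lemma extend_of_notMem {N : ℕ} (x : CoeffVec N) {k : ℤ} (hk : k ∉ freq N) : extend x k = 0 :=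
  dif_neg hk

lemma extend_restrict {N : ℕ} {f : ℤ → ℂ} (hf : ∀ k ∉ freq N, f k = 0) :
    extend (fun k : {k : ℤ // k ∈ freq N} => f k) = f := by
  ext k
  by_cases hk : k ∈ freq N
  · rw [extend_of_mem _ hk]
  · rw [extend_of_notMem _ hk, hf k hk]

lemma contDiff_extend {E : Type*} [NormedAddCommGroup E] [NormedSpace ℝ E] {N : ℕ}
    {f : E → CoeffVec N} (hf : ContDiff ℝ 1 f) (k : ℤ) : ContDiff ℝ 1 fun x => extend (f x) k := by
  by_cases hk : k ∈ freq N
  · simp only [extend_of_mem _ hk]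
    exact contDiff_pi.1 hf _
  · simp only [extend_of_notMem _ hk]
    exact contDiff_const

lemma contDiff_dconv {E : Type*} [NormedAddCommGroup E] [NormedSpace ℝ E] {N : ℕ}
    {f g : E → CoeffVec N} (hf : ContDiff ℝ 1 f) (hg : ContDiff ℝ 1 g) (k : ℤ) :
    ContDiff ℝ 1 fun x => dconv N (extend (f x)) (extend (g x)) k := by
  unfold dconv
  exact ContDiff.sum fun j _ => (contDiff_extend hf j).mul (contDiff_extend hg _)

/-- The right-hand side of the `ζ` equation in terms of coefficient vectors. -/
def fieldζ (p : BBParams) (N : ℕ) (x : CoeffVec N × CoeffVec N) (k : ℤ) : ℂ :=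
  rhsζ p k (extend x.2 k) (dconv N (extend x.1) (extend x.2) k)

/-- The right-hand side of the `u` equation in terms of coefficient vectors. -/
def fieldu (p : BBParams) (N : ℕ) (x : CoeffVec N × CoeffVec N) (k : ℤ) : ℂ :=
  rhsu p k (extend x.1 k) (dconv N (extend x.2) (extend x.2) k)

lemma contDiff_fieldζ (p : BBParams) (N : ℕ) (k : ℤ) : ContDiff ℝ 1 fun x => fieldζ p N x k := by
  unfold fieldζ rhsζ
  exact (contDiff_const.mul (contDiff_extend contDiff_snd k)).sub
    (contDiff_const.mul (contDiff_dconv contDiff_fst contDiff_snd k))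

lemma contDiff_fieldu (p : BBParams) (N : ℕ) (k : ℤ) : ContDiff ℝ 1 fun x => fieldu p N x k := by
  unfold fieldu rhsu
  exact ((contDiff_const.mul (contDiff_extend contDiff_fst k)).sub
    ((contDiff_const.mul (contDiff_dconv contDiff_snd contDiff_snd k)).div_const 2)).div_const _

lemma IsModal.eqOn {p : BBParams} {T : ℝ} {N : ℕ} {ζ₀ u₀ : ℝ → ℝ} {z w z' w' : ℝ → ℤ → ℂ}
    (h : IsModal p T N ζ₀ u₀ z w) (h' : IsModal p T N ζ₀ u₀ z' w') {t : ℝ} (ht : t ∈ Icc 0 T) :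
    z t = z' t ∧ w t = w' t := by
  set F : CoeffVec N × CoeffVec N → CoeffVec N × CoeffVec N :=
    fun x => (fun k => fieldζ p N x k, fun k => fieldu p N x k) with hF
  have cF : ContDiff ℝ 1 F :=
    (contDiff_pi.2 fun k : {k : ℤ // k ∈ freq N} => contDiff_fieldζ p N k).prodMk
      (contDiff_pi.2 fun k : {k : ℤ // k ∈ freq N} => contDiff_fieldu p N k)
  have key : ∀ {z w : ℝ → ℤ → ℂ}, IsModal p T N ζ₀ u₀ z w → ∀ t ∈ Icc 0 T,
      HasDerivWithinAt (fun r => ((fun k => z r k, fun k => w r k) : CoeffVec N × CoeffVec N))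
        (F (fun k => z t k, fun k => w t k)) (Icc 0 T) t := by
    intro z w h t ht
    have e1 := extend_restrict (h.supp_z t ht)
    have e2 := extend_restrict (h.supp_w t ht)
    refine HasDerivWithinAt.prodMk (hasDerivWithinAt_pi.2 fun k => ?_)
      (hasDerivWithinAt_pi.2 fun k => ?_)
    · have := h.deriv_z t ht k k.2
      simp only [fieldζ, e1, e2]
      exact this
    · have := h.deriv_w t ht k k.2
      simp only [fieldu, e1, e2]
      exact this
  have := solution_unique_of_contDiff cF (key h) (key h') (by
    simp only [h.init_z _ (Subtype.prop _), h'.init_z _ (Subtype.prop _),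
      h.init_w _ (Subtype.prop _), h'.init_w _ (Subtype.prop _)]) ht
  simp only [Prod.mk.injEq] at this
  constructor <;> ext k <;> by_cases hk : k ∈ freq N
  · exact congrFun this.1 ⟨k, hk⟩
  · rw [h.supp_z t ht k hk, h'.supp_z t ht k hk]
  · exact congrFun this.2 ⟨k, hk⟩
  · rw [h.supp_w t ht k hk, h'.supp_w t ht k hk]

lemma conj_dconv {N : ℕ} {z w : ℤ → ℂ} (hz : ∀ k, z (-k) = (starRingEnd ℂ) (z k))
    (hw : ∀ k, w (-k) = (starRingEnd ℂ) (w k)) (k : ℤ) :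
    dconv N z w (-k) = (starRingEnd ℂ) (dconv N z w k) := by
  rw [dconv, dconv, map_sum]
  refine Finset.sum_nbij' (fun j => -j) (fun j => -j) ?_ ?_ ?_ ?_ ?_
  · intro j hj; exact neg_mem_freq.2 hj
  · intro j hj; exact neg_mem_freq.2 hj
  · simp
  · simp
  · intro j _
    rw [map_mul, ← hz, ← hw, neg_neg, show -(k - -j) = -k - j by ring]

lemma conj_rhsζ (p : BBParams) (k : ℤ) (w P : ℂ) :
    rhsζ p (-k) ((starRingEnd ℂ) w) ((starRingEnd ℂ) P) = (starRingEnd ℂ) (rhsζ p k w P) := by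
  simp only [rhsζ, sym_neg, map_sub, map_mul, map_neg, map_add, map_pow, conj_sym,
    Complex.conj_ofReal]

lemma conj_rhsu (p : BBParams) (k : ℤ) (z P : ℂ) :
    rhsu p (-k) ((starRingEnd ℂ) z) ((starRingEnd ℂ) P) = (starRingEnd ℂ) (rhsu p k z P) := by
  simp only [rhsu, sym_neg, map_sub, map_mul, map_neg, map_pow, map_div₀, conj_sym,
    Complex.conj_ofReal, map_one, map_ofNat]

/-- A curve with reflection-symmetric derivative and initial value is reflection-symmetric. -/
lemma conj_of_hasDerivWithinAt {T : ℝ} {f g : ℝ → ℂ} {f' g' : ℝ → ℂ}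
    (hf : ∀ t ∈ Icc 0 T, HasDerivWithinAt f (f' t) (Icc 0 T) t)
    (hg : ∀ t ∈ Icc 0 T, HasDerivWithinAt g (g' t) (Icc 0 T) t)
    (h : ∀ t, g' t = (starRingEnd ℂ) (f' t)) (h0 : g 0 = (starRingEnd ℂ) (f 0)) :
    ∀ t ∈ Icc 0 T, g t = (starRingEnd ℂ) (f t) := by
  have hd : ∀ t ∈ Icc 0 T,
      HasDerivWithinAt (fun r => g r - (starRingEnd ℂ) (f r)) 0 (Icc 0 T) t := by
    intro t ht
    have h1 : HasDerivWithinAt (fun r => (starRingEnd ℂ) (f r)) ((starRingEnd ℂ) (f' t))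
        (Icc 0 T) t :=
      (Complex.conjCLE : ℂ →L[ℝ] ℂ).hasFDerivAt.comp_hasDerivWithinAt t (hf t ht)
    have := (hg t ht).sub h1
    rwa [h t, sub_self] at this
  intro t ht
  have := constant_of_has_deriv_right_zero (fun t ht => (hd t ht).continuousWithinAt)
    (fun t ht => (hd t (Ico_subset_Icc_self ht)).mono_of_mem_nhdsWithin
      (Icc_mem_nhdsGE_of_mem ht)) t ht
  rw [h0, sub_self] at this
  exact sub_eq_zero.1 this

/-- The symmetrization of a family of coefficients under `k ↦ -k` and complex conjugation. -/
def symm (f : ℤ → ℂ) (k : ℤ) : ℂ := (f k + (starRingEnd ℂ) (f (-k))) / 2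

lemma symm_neg (f : ℤ → ℂ) (k : ℤ) : symm f (-k) = (starRingEnd ℂ) (symm f k) := by
  simp only [symm, neg_neg, map_div₀, map_add, Complex.conj_conj, map_ofNat, add_comm]

lemma symm_eq {f : ℤ → ℂ} (h : ∀ k, f (-k) = (starRingEnd ℂ) (f k)) (k : ℤ) : symm f k = f k := by
  rw [symm, h, Complex.conj_conj, add_self_div_two]

lemma contDiff_symm {E : Type*} [NormedAddCommGroup E] [NormedSpace ℝ E] {f : E → ℤ → ℂ}
    (hf : ∀ k, ContDiff ℝ 1 fun x => f x k) (k : ℤ) : ContDiff ℝ 1 fun x => symm (f x) k :=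
  ((hf k).add ((Complex.conjCLE : ℂ →L[ℝ] ℂ).contDiff.comp (hf (-k)))).div_const 2

/-- The semidiscrete problem with the vector field cut off outside a ball is globally solvable,
with real-valued solutions. -/
lemma exists_cutoff_solution (p : BBParams) (N : ℕ) {T : ℝ} (hT : 0 ≤ T) (ζ₀ u₀ : ℝ → ℝ) (R : ℝ) :
    ∃ z w z' w' : ℝ → ℤ → ℂ,
      (∀ t, ∀ k ∉ freq N, z t k = 0) ∧ (∀ t, ∀ k ∉ freq N, w t k = 0) ∧
      (∀ t ∈ Icc 0 T, ∀ k, z t (-k) = (starRingEnd ℂ) (z t k)) ∧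
      (∀ t ∈ Icc 0 T, ∀ k, w t (-k) = (starRingEnd ℂ) (w t k)) ∧
      (∀ k ∈ freq N, z 0 k = fhat ζ₀ k) ∧ (∀ k ∈ freq N, w 0 k = fhat u₀ k) ∧
      (∀ t ∈ Icc 0 T, ∀ k ∈ freq N, HasDerivWithinAt (fun r => z r k) (z' t k) (Icc 0 T) t) ∧
      (∀ t ∈ Icc 0 T, ∀ k ∈ freq N, HasDerivWithinAt (fun r => w r k) (w' t k) (Icc 0 T) t) ∧
      (∀ t ∈ Icc 0 T, (∀ k ∈ freq N, ‖z t k‖ ≤ R) → (∀ k ∈ freq N, ‖w t k‖ ≤ R) →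
        ∀ k ∈ freq N, z' t k = rhsζ p k (w t k) (dconv N (z t) (w t) k) ∧
          w' t k = rhsu p k (z t k) (dconv N (w t) (w t) k)) := by
  -- Radii built from `|R|` are positive for every `R`. The norm is the maximum norm, so bounds on
  -- single coefficients place the state where the cutoff equals 1.
  set χ : ContDiffBump (0 : CoeffVec N × CoeffVec N) :=
    ⟨|R| + 1, |R| + 2, by positivity, by linarith⟩ with hχ
  -- Symmetrizing makes the field reflection-symmetric at every state, so real solutions stay real
  -- whatever the cutoff does. On symmetric states it agrees with the Galerkin field.
  set F : CoeffVec N × CoeffVec N → CoeffVec N × CoeffVec N :=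
    fun x => (fun k => symm (fieldζ p N x) k, fun k => symm (fieldu p N x) k) with hF
  have cF : ContDiff ℝ 1 F :=
    (contDiff_pi.2 fun k : {k : ℤ // k ∈ freq N} => contDiff_symm (contDiff_fieldζ p N) k).prodMk
      (contDiff_pi.2 fun k : {k : ℤ // k ∈ freq N} => contDiff_symm (contDiff_fieldu p N) k)
  obtain ⟨α, hα0, hα⟩ := exists_solution_of_hasCompactSupport (G := fun x => χ x • F x)
    (χ.contDiff.smul cF) χ.hasCompactSupport.smul_right
    ((fun k => fhat ζ₀ k, fun k => fhat u₀ k) : CoeffVec N × CoeffVec N) hT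
  have dz : ∀ t ∈ Icc 0 T, ∀ k ∈ freq N, HasDerivWithinAt (fun r => extend (α r).1 k)
      (χ (α t) * symm (fieldζ p N (α t)) k) (Icc 0 T) t := by
    intro t ht k hk
    simp only [extend_of_mem _ hk]
    exact hasDerivWithinAt_pi.1
      ((ContinuousLinearMap.fst ℝ (CoeffVec N) (CoeffVec N)).hasFDerivAt.comp_hasDerivWithinAt t
        (hα t ht)) ⟨k, hk⟩
  have dw : ∀ t ∈ Icc 0 T, ∀ k ∈ freq N, HasDerivWithinAt (fun r => extend (α r).2 k)
      (χ (α t) * symm (fieldu p N (α t)) k) (Icc 0 T) t := by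
    intro t ht k hk
    simp only [extend_of_mem _ hk]
    exact hasDerivWithinAt_pi.1
      ((ContinuousLinearMap.snd ℝ (CoeffVec N) (CoeffVec N)).hasFDerivAt.comp_hasDerivWithinAt t
        (hα t ht)) ⟨k, hk⟩
  have iz : ∀ k ∈ freq N, extend (α 0).1 k = fhat ζ₀ k := fun k hk => by
    rw [extend_of_mem _ hk, hα0]
  have iw : ∀ k ∈ freq N, extend (α 0).2 k = fhat u₀ k := fun k hk => by
    rw [extend_of_mem _ hk, hα0]
  have sz : ∀ t ∈ Icc 0 T, ∀ k, extend (α t).1 (-k) = (starRingEnd ℂ) (extend (α t).1 k) := by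
    intro t ht k
    by_cases hk : k ∈ freq N
    · have hk' := neg_mem_freq.2 hk
      refine conj_of_hasDerivWithinAt (fun t ht => dz t ht k hk) (fun t ht => dz t ht (-k) hk')
        (fun t => ?_) ?_ t ht
      · rw [symm_neg, map_mul, Complex.conj_ofReal]
      · rw [iz _ hk, iz _ hk', fhat_neg]
    · rw [extend_of_notMem _ hk, extend_of_notMem _ (fun h => hk (neg_mem_freq.1 h)), map_zero]
  have sw : ∀ t ∈ Icc 0 T, ∀ k, extend (α t).2 (-k) = (starRingEnd ℂ) (extend (α t).2 k) := by
    intro t ht k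
    by_cases hk : k ∈ freq N
    · have hk' := neg_mem_freq.2 hk
      refine conj_of_hasDerivWithinAt (fun t ht => dw t ht k hk) (fun t ht => dw t ht (-k) hk')
        (fun t => ?_) ?_ t ht
      · rw [symm_neg, map_mul, Complex.conj_ofReal]
      · rw [iw _ hk, iw _ hk', fhat_neg]
    · rw [extend_of_notMem _ hk, extend_of_notMem _ (fun h => hk (neg_mem_freq.1 h)), map_zero]
  refine ⟨fun t => extend (α t).1, fun t => extend (α t).2, _, _,
    fun t k hk => extend_of_notMem _ hk, fun t k hk => extend_of_notMem _ hk, sz, sw, iz, iw,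
    dz, dw, fun t ht hz hw k hk => ?_⟩
  have hR : 0 ≤ |R| + 1 := by positivity
  have hone : χ (α t) = 1 := by
    apply χ.one_of_mem_closedBall
    rw [mem_closedBall_zero_iff, Prod.norm_def]
    refine max_le ((pi_norm_le_iff_of_nonneg hR).2 fun j => ?_)
      ((pi_norm_le_iff_of_nonneg hR).2 fun j => ?_)
    · have : ‖extend (α t).1 j‖ ≤ R := hz j j.2
      rw [extend_of_mem _ j.2] at this
      linarith [le_abs_self R]
    · have : ‖extend (α t).2 j‖ ≤ R := hw j j.2
      rw [extend_of_mem _ j.2] at this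
      linarith [le_abs_self R]
  rw [hone, Complex.ofReal_one, one_mul, one_mul]
  constructor
  · refine symm_eq (fun j => ?_) k
    rw [fieldζ, fieldζ, sw t ht, conj_dconv (sz t ht) (sw t ht), conj_rhsζ]
  · refine symm_eq (fun j => ?_) k
    rw [fieldu, fieldu, sz t ht, conj_dconv (sw t ht) (sw t ht), conj_rhsu]

/-! ### From the energy to the norms of the theorem -/

lemma sqInt_of_mem {N : ℕ} {g : ℝ → ℝ} (h : toC g ∈ trigSpace N) : SqInt g := by
  have hc := (contDiff_of_mem h).continuous
  obtain ⟨C, hC⟩ := (isCompact_Icc (a := (0 : ℝ)) (b := 1)).exists_bound_of_continuousOn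
    hc.continuousOn
  exact MemLp.of_bound hc.aestronglyMeasurable C
    ((ae_restrict_iff' measurableSet_Ioc).2 (ae_of_all _ fun x hx => hC x (Ioc_subset_Icc_self hx)))

lemma tsum_eq_sum_freq_add_tail {N : ℕ} {q q' : ℤ → ℝ} (h : ∀ k ∉ freq N, q k = q' k)
    (h' : ∀ k ∈ freq N, q' k = 0) (hs : Summable q') :
    HasSum q (∑ k ∈ freq N, q k + ∑' k, q' k) := by
  have h1 : HasSum (fun k => if k ∈ freq N then q k else 0) (∑ k ∈ freq N, q k) := by
    have : HasSum (fun k => if k ∈ freq N then q k else 0)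
        (∑ k ∈ freq N, if k ∈ freq N then q k else 0) :=
      hasSum_sum_of_ne_finset_zero fun k hk => if_neg hk
    rwa [Finset.sum_congr rfl fun k hk => if_pos hk] at this
  convert h1.add hs.hasSum using 1
  ext k
  by_cases hk : k ∈ freq N
  · rw [if_pos hk, h' k hk, add_zero]
  · rw [if_neg hk, h k hk, zero_add]

/-- The `L²` norm of the error is controlled by its low frequencies and the tail of the exact
solution. -/
lemma l2Norm_sub_sq_le {N : ℕ} {f g : ℝ → ℝ} (hf : toC f ∈ trigSpace N) (hg : SqInt g)
    (hs : Wsum (fhat g)) : l2Norm (fun x => f x - g x) ^ 2 ≤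
      ∑ k ∈ freq N, ‖(fhat f - trunc N (fhat g)) k‖ ^ 2
        + ∑' k, (wt k * ‖tail N (fhat g) k‖) ^ 2 := by
  have hf2 := sqInt_of_mem hf
  have h1 := hasSum_norm_sq_fhat (hf2.sub hg)
  have h0 : 0 ≤ ∫ x in (0 : ℝ)..1, (f x - g x) ^ 2 :=
    intervalIntegral.integral_nonneg zero_le_one fun x _ => sq_nonneg _
  rw [l2Norm, Real.sq_sqrt h0]
  have e : ∀ k, fhat (f - g) k = fhat f k - fhat g k := fhat_sub hf2 hg
  have hts := summable_tail_sq (N := N) hs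
  have hle : ∀ k, ‖tail N (fhat g) k‖ ^ 2 ≤ (wt k * ‖tail N (fhat g) k‖) ^ 2 := fun k =>
    pow_le_pow_left₀ (norm_nonneg _) (le_mul_of_one_le_left (norm_nonneg _) (one_le_wt k)) 2
  have hts' : Summable fun k => ‖tail N (fhat g) k‖ ^ 2 :=
    Summable.of_nonneg_of_le (fun _ => sq_nonneg _) hle hts
  have h2 := tsum_eq_sum_freq_add_tail (N := N) (q := fun k => ‖fhat (f - g) k‖ ^ 2)
    (q' := fun k => ‖tail N (fhat g) k‖ ^ 2)
    (fun k hk => by simp only [e, tail, if_neg hk, fhat_eq_zero_of_mem hf hk, zero_sub, norm_neg])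
    (fun k hk => by simp only [tail, if_pos hk, norm_zero]; norm_num) hts'
  rw [show (∫ x in (0 : ℝ)..1, (f x - g x) ^ 2) = _ from h1.unique h2]
  refine add_le_add (Finset.sum_le_sum fun k hk => ?_) (hts'.tsum_le_tsum hle hts)
  simp only [e, Pi.sub_apply, trunc, if_pos hk, le_refl]

lemma sobolevNorm_sub_sq_le {N : ℕ} {f g : ℝ → ℝ} (hf : toC f ∈ trigSpace N) (hg : SqInt g)
    (hs : Wsum (fhat g)) : sobolevNorm 1 (fun x => f x - g x) ^ 2 ≤
      ∑ k ∈ freq N, (wt k ^ 2 * ‖(fhat f - trunc N (fhat g)) k‖) ^ 2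
        + ∑' k, (wt k * ‖tail N (fhat g) k‖) ^ 2 := by
  have hf2 := sqInt_of_mem hf
  rw [sobolevNorm, ← sobSq, Real.sq_sqrt (sobSq_nonneg 1 _), sobSq]
  simp only [fhat_sub hf2 hg, Real.rpow_one]
  have hts := summable_tail_sq (N := N) hs
  have hle : ∀ k : ℤ, (1 + (k : ℝ) ^ 2) * ‖tail N (fhat g) k‖ ^ 2 ≤
      (wt k * ‖tail N (fhat g) k‖) ^ 2 := fun k => by
    rw [mul_pow]; exact mul_le_mul_of_nonneg_right (le_wt_sq k) (sq_nonneg _)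
  have hts' : Summable fun k : ℤ => (1 + (k : ℝ) ^ 2) * ‖tail N (fhat g) k‖ ^ 2 :=
    Summable.of_nonneg_of_le (fun _ => by positivity) hle hts
  have h2 := tsum_eq_sum_freq_add_tail (N := N)
    (q := fun k : ℤ => (1 + (k : ℝ) ^ 2) * ‖fhat f k - fhat g k‖ ^ 2)
    (q' := fun k : ℤ => (1 + (k : ℝ) ^ 2) * ‖tail N (fhat g) k‖ ^ 2)
    (fun k hk => by simp only [tail, if_neg hk, fhat_eq_zero_of_mem hf hk, zero_sub, norm_neg])
    (fun k hk => by simp only [tail, if_pos hk, norm_zero]; norm_num) hts'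
  rw [h2.tsum_eq]
  refine add_le_add (Finset.sum_le_sum fun k hk => ?_) (hts'.tsum_le_tsum hle hts)
  rw [Pi.sub_apply, trunc, if_pos hk, mul_pow]
  refine mul_le_mul_of_nonneg_right ?_ (sq_nonneg _)
  have h1 := le_wt_sq k
  have h2 := one_le_wt k
  nlinarith

lemma norms_le_of_energy_le {p : BBParams} (hp : p.Physical) (hvi : p.CaseVI) {N : ℕ}
    {f g f' g' : ℝ → ℝ} {X : ℝ} (hf : toC f ∈ trigSpace N) (hg : toC g ∈ trigSpace N)
    (hf' : SqInt f') (hg' : SqInt g') (sf : Wsum (fhat f')) (sg : Wsum (fhat g'))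
    (hX : energy p N (fhat f - trunc N (fhat f')) (fhat g - trunc N (fhat g'))
      + ∑' k, (wt k * ‖tail N (fhat f') k‖) ^ 2 + ∑' k, (wt k * ‖tail N (fhat g') k‖) ^ 2 ≤ X) :
    l2Norm (fun x => f x - f' x) + sobolevNorm 1 (fun x => g x - g' x) ≤
      2 * Real.sqrt (((p.κ₂)⁻¹ + (coer p)⁻¹ + 1) * X) := by
  have hκ := inv_pos.2 (κ₂_pos hp)
  have hc := inv_pos.2 (coer_pos hp hvi)
  have hE := energy_nonneg hp hvi N (fhat f - trunc N (fhat f')) (fhat g - trunc N (fhat g'))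
  have ht1 : 0 ≤ ∑' k, (wt k * ‖tail N (fhat f') k‖) ^ 2 := tsum_nonneg fun _ => sq_nonneg _
  have ht2 : 0 ≤ ∑' k, (wt k * ‖tail N (fhat g') k‖) ^ 2 := tsum_nonneg fun _ => sq_nonneg _
  have a1 := l2Norm_sub_sq_le hf hf' sf
  have a2 := sobolevNorm_sub_sq_le hg hg' sg
  have b1 := sum_sq_le_energy hp hvi N (fhat f - trunc N (fhat f')) (fhat g - trunc N (fhat g'))
  have b2 := sum_wt_sq_le_energy hp hvi N (fhat f - trunc N (fhat f'))
    (fhat g - trunc N (fhat g'))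
  set E := energy p N (fhat f - trunc N (fhat f')) (fhat g - trunc N (fhat g'))
  set τ1 := ∑' k, (wt k * ‖tail N (fhat f') k‖) ^ 2
  set τ2 := ∑' k, (wt k * ‖tail N (fhat g') k‖) ^ 2
  have c1 : l2Norm (fun x => f x - f' x) ≤ Real.sqrt (((p.κ₂)⁻¹ + (coer p)⁻¹ + 1) * X) := by
    apply Real.le_sqrt_of_sq_le
    nlinarith [mul_nonneg hκ.le ht1, mul_nonneg hκ.le ht2, mul_nonneg hc.le ht1,
      mul_nonneg hc.le ht2, mul_nonneg hc.le hE, mul_nonneg hκ.le hE,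
      mul_le_mul_of_nonneg_left hX (by positivity : 0 ≤ (p.κ₂)⁻¹ + (coer p)⁻¹ + 1)]
  have c2 : sobolevNorm 1 (fun x => g x - g' x) ≤
      Real.sqrt (((p.κ₂)⁻¹ + (coer p)⁻¹ + 1) * X) := by
    apply Real.le_sqrt_of_sq_le
    nlinarith [mul_nonneg hκ.le ht1, mul_nonneg hκ.le ht2, mul_nonneg hc.le ht1,
      mul_nonneg hc.le ht2, mul_nonneg hc.le hE, mul_nonneg hκ.le hE,
      mul_le_mul_of_nonneg_left hX (by positivity : 0 ≤ (p.κ₂)⁻¹ + (coer p)⁻¹ + 1)]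
  linarith

lemma IsSemidiscrete.unique {p : BBParams} (hvi : p.CaseVI) {T : ℝ} (hT : 0 < T) {N : ℕ}
    {ζ₀ u₀ : ℝ → ℝ} {ζN uN ζN' uN' : ℝ → ℝ → ℝ} (h : IsSemidiscrete p T N ζ₀ u₀ ζN uN)
    (h' : IsSemidiscrete p T N ζ₀ u₀ ζN' uN') {t : ℝ} (ht : t ∈ Icc 0 T) :
    ζN t = ζN' t ∧ uN t = uN' t := by
  obtain ⟨e1, e2⟩ := (h.isModal hvi hT).eqOn (h'.isModal hvi hT) ht
  have inj : ∀ {f g : ℝ → ℝ}, toC f ∈ trigSpace N → toC g ∈ trigSpace N → fhat f = fhat g →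
      f = g := fun {f g} hf hg hfg => by
    have : toC f = toC g := by rw [eq_trig_of_mem hf, eq_trig_of_mem hg, hfg]
    ext x
    exact Complex.ofReal_injective (congrFun this x)
  exact ⟨inj (h.mem_ζ t ht) (h'.mem_ζ t ht) e1, inj (h.mem_u t ht) (h'.mem_u t ht) e2⟩

/-- Supplies the radius outside which the field may be cut off: below energy 1 no single error
coefficient is large. The summand 1 comes from x ≤ x² + 1. -/
lemma norm_sq_coeff_le_energy {p : BBParams} (hp : p.Physical) (hvi : p.CaseVI) {N : ℕ}
    {A B : ℤ → ℂ} (hE : energy p N A B ≤ 1) {k : ℤ} (hk : k ∈ freq N) :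
    ‖A k‖ ≤ (p.κ₂)⁻¹ + 1 ∧ ‖B k‖ ≤ (coer p)⁻¹ + 1 := by
  have hκ := inv_pos.2 (κ₂_pos hp)
  have hc := inv_pos.2 (coer_pos hp hvi)
  have b1 := sum_sq_le_energy hp hvi N A B
  have b2 := sum_wt_sq_le_energy hp hvi N A B
  have d1 := Finset.single_le_sum (f := fun k => ‖A k‖ ^ 2) (fun _ _ => sq_nonneg _) hk
  have d2 := Finset.single_le_sum (f := fun k => (wt k ^ 2 * ‖B k‖) ^ 2)
    (fun _ _ => sq_nonneg _) hk
  have e1 := mul_le_of_le_one_right hκ.le hE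
  have e2 := mul_le_of_le_one_right hc.le hE
  have d3 : ‖B k‖ ^ 2 ≤ (wt k ^ 2 * ‖B k‖) ^ 2 :=
    pow_le_pow_left₀ (norm_nonneg _)
      (le_mul_of_one_le_left (norm_nonneg _) (one_le_pow₀ (one_le_wt k))) 2
  constructor
  · nlinarith [sq_nonneg (‖A k‖ - 1), norm_nonneg (A k)]
  · nlinarith [sq_nonneg (‖B k‖ - 1), norm_nonneg (B k)]

lemma norm_le_wnorm {f : ℤ → ℂ} (hf : Wsum f) (k : ℤ) : ‖f k‖ ≤ wnorm f :=
  (le_mul_of_one_le_left (norm_nonneg _) (one_le_wt k)).trans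
    (hf.le_tsum k fun j _ => wt_mul_norm_nonneg f j)

/-- Existence of the semidiscrete solution for fine discretizations. -/
lemma IsSolution.exists_isSemidiscrete {p : BBParams} (hp : p.Physical) (hvi : p.CaseVI)
    {s T : ℝ} (hs : 3 / 2 < s) (hT : 0 < T) {ζ₀ u₀ : ℝ → ℝ} {ζ u : ℝ → ℝ → ℝ}
    (h : IsSolution p s T ζ₀ u₀ ζ u) : ∃ C, 0 < C ∧ ∀ N : ℕ, 1 ≤ N →
      C * ((N : ℝ) ^ (1 - s)) ^ 2 ≤ 1 →
      (∃ ζN uN, IsSemidiscrete p T N ζ₀ u₀ ζN uN) ∧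
      ∀ ζN uN, IsSemidiscrete p T N ζ₀ u₀ ζN uN → ∀ t ∈ Icc 0 T,
        energy p N (fhat (ζN t) - trunc N (fhat (ζ t))) (fhat (uN t) - trunc N (fhat (u t))) ≤
          C * ((N : ℝ) ^ (1 - s)) ^ 2 := by
  obtain ⟨C, hC, key⟩ := h.exists_energy_le hp hvi hs
  obtain ⟨ζt, ut, hζ, hu, -⟩ := h.2.2
  obtain ⟨M₁, hM₁, b₁⟩ := hζ.fourier_bounds hs
  obtain ⟨M₂, hM₂, b₂⟩ := hu.fourier_bounds hs
  have hκ := inv_pos.2 (κ₂_pos hp)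
  have hc := inv_pos.2 (coer_pos hp hvi)
  refine ⟨C, hC, fun N hN hsmall => ⟨?_, fun ζN uN hN' => ?_⟩⟩
  · obtain ⟨z, w, z', w', supz, supw, cz, cw, iz, iw, dz, dw, heq⟩ :=
      -- The radius exceeds the coefficients of the exact solution (M₁, M₂) plus those of any error
      -- of energy at most 1.
      exists_cutoff_solution p N hT.le ζ₀ u₀ (M₁ + M₂ + (p.κ₂)⁻¹ + (coer p)⁻¹ + 1)
    have hmodal : ∀ t ∈ Icc 0 T,
        energy p N (z t - trunc N (fhat (ζ t))) (w t - trunc N (fhat (u t))) ≤ 1 →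
        ∀ k ∈ freq N, z' t k = rhsζ p k (w t k) (dconv N (z t) (w t) k) ∧
          w' t k = rhsu p k (z t k) (dconv N (w t) (w t) k) := by
      intro t ht hE
      refine heq t ht (fun k hk => ?_) (fun k hk => ?_)
      · have h1 := (norm_sq_coeff_le_energy hp hvi hE hk).1
        have h2 := (norm_le_wnorm (b₁ t ht).1 k).trans (b₁ t ht).2.1
        rw [Pi.sub_apply, trunc, if_pos hk] at h1
        have := norm_le_norm_sub_add (z t k) (fhat (ζ t) k)
        linarith
      · have h1 := (norm_sq_coeff_le_energy hp hvi hE hk).2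
        have h2 := (norm_le_wnorm (b₂ t ht).1 k).trans (b₂ t ht).2.1
        rw [Pi.sub_apply, trunc, if_pos hk] at h1
        have := norm_le_norm_sub_add (w t k) (fhat (u t) k)
        linarith
    -- The estimate requires the equations only while the energy is at most 1, and its conclusion
    -- keeps the energy there. The cutoff is therefore inactive on all of [0,T].
    have hE := key N z w z' w' hN (fun t _ => supz t) (fun t _ => supw t) cw iz iw dz dw hmodal
      hsmall
    have hm : IsModal p T N ζ₀ u₀ z w :=
      ⟨fun t _ => supz t, fun t _ => supw t, cz, cw, iz, iw,
        fun t ht k hk => by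
          rw [← (hmodal t ht ((hE t ht).trans hsmall) k hk).1]; exact dz t ht k hk,
        fun t ht k hk => by
          rw [← (hmodal t ht ((hE t ht).trans hsmall) k hk).2]; exact dw t ht k hk⟩
    exact ⟨_, _, hm.isSemidiscrete hvi hT⟩
  · have hm := hN'.isModal hvi hT
    exact key N _ _ _ _ hN hm.supp_z hm.supp_w hm.conj_w hm.init_z hm.init_w hm.deriv_z hm.deriv_w
      (fun t ht _ k hk => ⟨rfl, rfl⟩) hsmall

/-- For each `N` the energy of the error is bounded on `[0,T]`. -/
lemma IsSolution.exists_energy_bound {p : BBParams} (hvi : p.CaseVI)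
    {s T : ℝ} (hs : 3 / 2 < s) (hT : 0 < T) {ζ₀ u₀ : ℝ → ℝ} {ζ u : ℝ → ℝ → ℝ}
    (h : IsSolution p s T ζ₀ u₀ ζ u) (N : ℕ) : ∃ D, 0 ≤ D ∧
      ∀ ζN uN, IsSemidiscrete p T N ζ₀ u₀ ζN uN → ∀ t ∈ Icc 0 T,
        energy p N (fhat (ζN t) - trunc N (fhat (ζ t))) (fhat (uN t) - trunc N (fhat (u t))) ≤ D := by
  -- The bound must not depend on the chosen solution: uniqueness leaves at most one, whose energy
  -- is continuous on [0,T]; if there is none, any bound serves.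
  by_cases hex : ∃ ζN uN, IsSemidiscrete p T N ζ₀ u₀ ζN uN
  · obtain ⟨ζN, uN, hN⟩ := hex
    have hm := hN.isModal hvi hT
    have hcont : ContinuousOn (fun r => energy p N (fhat (ζN r) - trunc N (fhat (ζ r)))
        (fhat (uN r) - trunc N (fhat (u r)))) (Icc 0 T) := fun t ht =>
      (h.energy_hasDerivWithinAt hvi hs N ht (hm.deriv_z t ht) (hm.deriv_w t ht)).continuousWithinAt
    obtain ⟨D, hD⟩ := isCompact_Icc.exists_bound_of_continuousOn hcont
    refine ⟨|D|, abs_nonneg D, fun ζN' uN' hN' t ht => ?_⟩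
    obtain ⟨e1, e2⟩ := hN.unique hvi hT hN' ht
    rw [← e1, ← e2]
    exact (le_abs_self _).trans ((hD t ht).trans (le_abs_self D))
  · exact ⟨0, le_rfl, fun ζN uN hN => absurd ⟨ζN, uN, hN⟩ hex⟩

end BB

end

theorem mainTheorem6 (p : BBParams) (hp : p.Physical) (hvi : p.CaseVI)
    (μ T : ℝ) (hμ : 3 / 2 < μ) (hT : 0 < T)
    (ζ₀ u₀ : ℝ → ℝ) (ζ u : ℝ → ℝ → ℝ) (hsol : BB.IsSolution p μ T ζ₀ u₀ ζ u) :
    ∃ C : ℝ,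
      (∀ N : ℕ, 1 ≤ N → ∀ ζN uN : ℝ → ℝ → ℝ, BB.IsSemidiscrete p T N ζ₀ u₀ ζN uN →
        ∀ t ∈ Set.Icc 0 T,
          BB.l2Norm (fun x => ζN t x - ζ t x) + BB.sobolevNorm 1 (fun x => uN t x - u t x)
            ≤ C * (N : ℝ) ^ (1 - μ)) ∧
      (∃ N₀ : ℕ, ∀ N : ℕ, N₀ ≤ N →
        (∃ ζN uN : ℝ → ℝ → ℝ, BB.IsSemidiscrete p T N ζ₀ u₀ ζN uN) ∧
        (∀ ζN uN ζN' uN' : ℝ → ℝ → ℝ, BB.IsSemidiscrete p T N ζ₀ u₀ ζN uN →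
          BB.IsSemidiscrete p T N ζ₀ u₀ ζN' uN' →
          ∀ t ∈ Set.Icc 0 T, ζN t = ζN' t ∧ uN t = uN' t)) := by
  obtain ⟨C, hC, hfine⟩ := hsol.exists_isSemidiscrete hp hvi hμ hT
  choose D hD0 hD using hsol.exists_energy_bound hvi hμ hT
  obtain ⟨ζt, ut, hζ, hu, -⟩ := hsol.2.2
  obtain ⟨M₁, hM₁, b₁⟩ := hζ.fourier_bounds hμ
  obtain ⟨M₂, hM₂, b₂⟩ := hu.fourier_bounds hμ
  have htend : Tendsto (fun N : ℕ => C * ((N : ℝ) ^ (1 - μ)) ^ 2) atTop (𝓝 0) := by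
    have h1 : Tendsto (fun x : ℝ => x ^ (-(μ - 1))) atTop (𝓝 0) :=
      tendsto_rpow_neg_atTop (by linarith)
    have h2 := ((h1.comp tendsto_natCast_atTop_atTop).pow 2).const_mul C
    simpa [Function.comp_def] using h2
  obtain ⟨N₀, hN₀⟩ := eventually_atTop.1 (htend.eventually (ge_mem_nhds one_pos))
  set N₁ := max N₀ 1 with hN₁
  set ε : ℕ → ℝ := fun N => (N : ℝ) ^ (1 - μ) with hε
  have hεpos : ∀ N : ℕ, 1 ≤ N → 0 < ε N := fun N hN => by
    have : (0 : ℝ) < N := by exact_mod_cast hN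
    positivity
  set b := (p.κ₂)⁻¹ + (BB.coer p)⁻¹ + 1 with hb
  have hb0 : 0 ≤ b := by
    have := inv_pos.2 (BB.κ₂_pos hp)
    have := inv_pos.2 (BB.coer_pos hp hvi)
    positivity
  have hstep : ∀ N : ℕ, 1 ≤ N → ∀ ζN uN : ℝ → ℝ → ℝ, BB.IsSemidiscrete p T N ζ₀ u₀ ζN uN →
      ∀ t ∈ Set.Icc 0 T, ∀ Y : ℝ, BB.energy p N (BB.fhat (ζN t) - BB.trunc N (BB.fhat (ζ t)))
        (BB.fhat (uN t) - BB.trunc N (BB.fhat (u t))) ≤ Y * ε N ^ 2 →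
      BB.l2Norm (fun x => ζN t x - ζ t x) + BB.sobolevNorm 1 (fun x => uN t x - u t x)
        ≤ 2 * Real.sqrt (b * (Y + M₁ + M₂)) * ε N := by
    intro N hN ζN uN hs t ht Y hY
    obtain ⟨s1, -, t1⟩ := b₁ t ht
    obtain ⟨s2, -, t2⟩ := b₂ t ht
    have h1 := BB.norms_le_of_energy_le hp hvi (hs.mem_ζ t ht) (hs.mem_u t ht)
      (hζ.mem t ht).memLp (hu.mem t ht).memLp s1 s2 (X := (Y + M₁ + M₂) * ε N ^ 2) (by
        have := t1 N hN
        have := t2 N hN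
        linarith)
    rwa [← mul_assoc, Real.sqrt_mul' _ (sq_nonneg _), Real.sqrt_sq (hεpos N hN).le,
      ← mul_assoc] at h1
  -- The first term serves `N ≥ N₁`, where the energy estimate applies. For each `N` below `N₁` the
  -- crude bound `D N` is rescaled by `ε N ^ 2`; summing over all of them, including the harmless
  -- index 0, dominates each one.
  refine ⟨2 * Real.sqrt (b * (C + M₁ + M₂)) +
    ∑ n ∈ Finset.range N₁, 2 * Real.sqrt (b * (D n / ε n ^ 2 + M₁ + M₂)), ?_, N₁, ?_⟩
  · intro N hN ζN uN hs t ht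
    have hpos := hεpos N hN
    have hsum : ∀ n ∈ Finset.range N₁, 0 ≤ 2 * Real.sqrt (b * (D n / ε n ^ 2 + M₁ + M₂)) :=
      fun n _ => by positivity
    by_cases hlt : N < N₁
    · refine (hstep N hN ζN uN hs t ht (D N / ε N ^ 2) ?_).trans
        (mul_le_mul_of_nonneg_right ?_ hpos.le)
      · rw [div_mul_cancel₀ _ (by positivity)]
        exact hD N ζN uN hs t ht
      · have := Finset.single_le_sum hsum (Finset.mem_range.2 hlt)
        have h0 : 0 ≤ Real.sqrt (b * (C + M₁ + M₂)) := Real.sqrt_nonneg _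
        linarith
    · have hle := hN₀ N ((le_max_left _ _).trans (not_lt.1 hlt))
      refine (hstep N hN ζN uN hs t ht C ((hfine N hN hle).2 ζN uN hs t ht)).trans
        (mul_le_mul_of_nonneg_right ?_ hpos.le)
      have := Finset.sum_nonneg hsum
      linarith
  · intro N hN
    have h1 : 1 ≤ N := (le_max_right _ _).trans hN
    exact ⟨(hfine N h1 (hN₀ N ((le_max_left _ _).trans hN))).1,
      fun ζN uN ζN' uN' h h' t ht => h.unique hvi hT h' ht⟩
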